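/- Let $N\ge 1$ be an integer, write $\mathrm{e}(z):=e^{2\pi i z}$, $P_N:=\{1,\dots,N\}$, and let $\mathcal{C}:=\{z\in\mathbb{C} : \mathrm{Re}(z)>0\}\cup i\mathbb{R}_{>0}$. **Domains.** Let $\mathbb{D}_N$ be the set of all $(w,a,\theta)\in\mathbb{C}\times\mathbb{C}^N\times\mathbb{R}^N$ such that $\theta_\ell\notin\mathbb{Z}$ whenever $a_\ell=0$. Put $\pi(w,a,\theta):=w-\sum_{\ell:\,a_\ell\in-\mathcal{C}}a_\ell$ and $\widetilde{\mathcal{D}}_N:=\{\delta\in\mathbb{D}_N : \pi(\delta)\in\mathcal{C}\}$. Let $\mathcal{T}_N^+$ be the set of $(w,a,\theta)\in\mathbb{C}\times\mathbb{C}^N\times\mathbb{R}^N$ with $\mathrm{Re}(w)>0$ and $\mathrm{Re}(a_\ell)>0$ for all $\ell$. For $\alpha\in\mathbb{C}^*$ put $M_\alpha(w,a,\theta):=(\alpha w,\alpha a,\theta)$. For $\Lambda\subseteq P_N$ put $T_\Lambda(w,a,\theta):=(w-\sum_{\ell\in\Lambda}a_\ell,\,a',\,\theta')$, where $a',\theta'$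 arise from $a,\theta$ by changing the signs of the entries with index in $\Lambda$. Let $p(w,a,\theta):=(w,a)$. **Hankel integrals.** Put $F_N(u,w,a,\theta):=e^{-uw}\prod_{\ell=1}^N(1-\mathrm{e}(\theta_\ell)e^{-ua_\ell})^{-1}$. Let $\mathcal{E}$ be the set of functions $\epsilon:\mathbb{D}_N\to\mathbb{R}_{>0}$ such that, for all $(w,a,\theta)\in\mathbb{D}_N$ and $\ell\in P_N$, the equation $\mathrm{e}(\theta_\ell)=e^{ua_\ell}$ has no solution $u\in\mathbb{C}$ with $0<|u|\le\epsilon(w,a,\theta)$. Let $$\mathcal{L}_{N,\epsilon}(s,\delta):=\frac{1}{\Gamma(s)(\mathrm{e}(s)-1)}\int_{C(\epsilon(\delta))}F_N(u,\delta)\,u^{s-1}\,du ,$$ where $C(r)$ is the Hankel contour that runs from $+\infty$ to $r$ (with $\mathrm{Arg}(u)=0$), counterclockwise along the circle $|u|=r$ (with $\mathrm{Arg}(u)$ increasing from $0$ to $2\pi$), and from $r$ to $+\infty$ (with $\mathrm{Arg}(u)=2\pi$), and $u^{s-1}:=e^{(s-1)(\log|u|+i\mathrm{Arg}(u))}$.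 At integers $s$, where the factor in front of the integral is not defined as written, $\mathcal{L}_{N,\epsilon}(s,\delta)$ denotes the limit as $s'\to s$, $s'\neq s$. **Twisted Barnes zeta function.** Let $\mathcal{T}_N^{\mathrm{ext}}:=\bigcup_{-\pi/2<\omega<\pi/2}M_{e^{i\omega}}^{-1}[\mathcal{T}_N^+]$. For fixed $\theta\in\mathbb{R}^N$, let $\zeta_N(s,w,a,\theta)$ be the holomorphic function of $(s,w,a)$ on $(\mathbb{C}\smallsetminus P_N)\times p(\mathcal{T}_N^{\mathrm{ext}})$ that, for $\mathrm{Re}(s)>N$ and $(w,a,\theta)\in\mathcal{T}_N^+$, is given by the absolutely convergent series $$\zeta_N(s,w,a,\theta)=\sum_{m\in\mathbb{Z}_{\ge0}^N}\mathrm{e}(m\cdot\theta)(w+m\cdot a)^{-s},$$ with the principal branch of the complex power. (This analytic continuation exists, and it is unique because the domain is connected.) **Theorem.** The set $\mathcal{E}$ is non-empty. For every $\delta\in\widetilde{\mathcal{D}}_N$ and all $\omega<0$ close enough to $0$, for every $\epsilon\in\mathcal{E}$, the Hankel integral in $\mathcal{L}_{N,\epsilon}(s,M_{e^{i\omega}}\delta)$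 converges absolutely for all $s\in\mathbb{C}$, and all singularities in $s$ of $\mathcal{L}_{N,\epsilon}(s,M_{e^{i\omega}}\delta)$ outside $P_N$ are removable. For all $s\in\mathbb{C}\smallsetminus P_N$ and $\delta\in\widetilde{\mathcal{D}}_N$ the limit $$\mathcal{L}_N(s,\delta):=\lim_{\omega\to0^-}\mathcal{L}_{N,\epsilon}\big(s,M_{e^{i\omega}}\delta\big)$$ exists and does not depend on $\epsilon\in\mathcal{E}$. Moreover: (i) For each fixed $\delta\in\widetilde{\mathcal{D}}_N$, the map $s\mapsto\mathcal{L}_N(s,\delta)$ is a meromorphic function on $\mathbb{C}$, holomorphic on $\mathbb{C}\smallsetminus P_N$, with at most simple poles at the points of $P_N$. (ii) For each fixed $\theta\in\mathbb{R}^N$ and each $\Lambda\subseteq P_N$, the map $(s,w,a)\mapsto\mathcal{L}_N(s,w,a,\theta)$ is holomorphic on $(\mathbb{C}\smallsetminus P_N)\times p\big(T_\Lambda(\mathcal{T}_N^+)\big)$. (iii) $\mathcal{L}_N(s,w,a,\theta)=\zeta_N(s,w,a,\theta)$ for all $s\in\mathbb{C}\smallsetminus P_N$, $w\in\mathcal{C}$,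 $a\in\mathcal{C}^N$ and $\theta\in\mathbb{R}^N$. -/

import Mathlib

open Filter Topology

namespace TwistedBarnes

noncomputable section

/-- Parameter triples `(w, a, θ)` in `ℂ × ℂ^N × ℝ^N`. -/
abbrev Params (N : ℕ) : Type := ℂ × (Fin N → ℂ) × (Fin N → ℝ)

/-- `e(z) = exp(2πiz)`. -/
def e (z : ℂ) : ℂ := Complex.exp (2 * Real.pi * Complex.I * z)

/-- The points `1, 2, …, N` of the complex plane. -/
def polePoints (N : ℕ) : Set ℂ := {s | ∃ k : ℕ, 1 ≤ k ∧ k ≤ N ∧ s = k}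

/-- The convex cone of all `z` with `Re z > 0` or `z ∈ i·ℝ_{>0}`. -/
def cone : Set ℂ := {z | 0 < z.re ∨ (z.re = 0 ∧ 0 < z.im)}

/-- The triples `(w, a, θ)` such that `θ ℓ` is not an integer whenever `a ℓ = 0`. -/
def goodDomain (N : ℕ) : Set (Params N) :=
  {δ | ∀ ℓ, δ.2.1 ℓ = 0 → ∀ n : ℤ, δ.2.2 ℓ ≠ n}

/-- The projection `(w, a, θ) ↦ (w, a)`. -/
def proj {N : ℕ} (δ : Params N) : ℂ × (Fin N → ℂ) := (δ.1, δ.2.1)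

/-- The trace `∑_{ℓ ∈ Λ} v ℓ`. -/
def trace {N : ℕ} (v : Fin N → ℂ) (Λ : Finset (Fin N)) : ℂ := ∑ ℓ ∈ Λ, v ℓ

open Classical in
/-- The set of indices `ℓ` with `a ℓ ∈ -cone`. -/
def negIndices {N : ℕ} (a : Fin N → ℂ) : Finset (Fin N) :=
  Finset.univ.filter (fun ℓ => -(a ℓ) ∈ cone)

/-- `π(w, a, θ) = w - Tr(a, {ℓ | a ℓ ∈ -cone})`. -/
def piMap {N : ℕ} (δ : Params N) : ℂ := δ.1 - trace δ.2.1 (negIndices δ.2.1)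

/-- The domain `π⁻¹[cone]` inside the good domain. -/
def extDomain (N : ℕ) : Set (Params N) := {δ | δ ∈ goodDomain N ∧ piMap δ ∈ cone}

/-- The domain `Re w > 0`, `Re (a ℓ) > 0` for all `ℓ`. -/
def TPlus (N : ℕ) : Set (Params N) := {δ | 0 < δ.1.re ∧ ∀ ℓ, 0 < (δ.2.1 ℓ).re}

/-- `T_Λ(w, a, θ) = (w - Tr(a, Λ), a', θ')`, the signs of `a ℓ` and `θ ℓ` being changed for
`ℓ ∈ Λ`. -/
def TMap {N : ℕ} (Λ : Finset (Fin N)) (δ : Params N) : Params N :=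
  (δ.1 - trace δ.2.1 Λ,
    fun ℓ => if ℓ ∈ Λ then -δ.2.1 ℓ else δ.2.1 ℓ,
    fun ℓ => if ℓ ∈ Λ then -δ.2.2 ℓ else δ.2.2 ℓ)

/-- `M_α(w, a, θ) = (α w, α a, θ)`. -/
def MMap {N : ℕ} (α : ℂ) (δ : Params N) : Params N :=
  (α * δ.1, fun ℓ => α * δ.2.1 ℓ, δ.2.2)

/-- The union over `ω ∈ (-π/2, π/2)` of the rotated domains `M_{exp(iω)}⁻¹[TPlus]`. -/
def TExt (N : ℕ) : Set (Params N) :=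
  {δ | ∃ ω : ℝ, -(Real.pi / 2) < ω ∧ ω < Real.pi / 2 ∧
    MMap (Complex.exp (Complex.I * ω)) δ ∈ TPlus N}

/-- `F_N(u, w, a, θ) = exp(-uw) ∏_ℓ (1 - e(θ ℓ) exp(-u a ℓ))⁻¹`. -/
def testFun {N : ℕ} (u : ℂ) (δ : Params N) : ℂ :=
  Complex.exp (-(u * δ.1)) *
    ∏ ℓ, (1 - e (δ.2.2 ℓ) * Complex.exp (-(u * δ.2.1 ℓ)))⁻¹

/-- The admissible radius functions: on the good domain they are positive, and
`e(θ ℓ) = exp(u a ℓ)` has no solution `u` with `0 < |u| ≤ ε(w, a, θ)`. Values outside the good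
domain are irrelevant. -/
def radii (N : ℕ) : Set (Params N → ℝ) :=
  {ε | ∀ δ ∈ goodDomain N, 0 < ε δ ∧
    ∀ ℓ, ∀ u : ℂ, 0 < ‖u‖ → ‖u‖ ≤ ε δ → e (δ.2.2 ℓ) ≠ Complex.exp (u * δ.2.1 ℓ)}

/-- `F_N(u, δ) u^{s-1}` at `u = r exp(it)`, where `r > 0` and the branch is `Arg u = t`. -/
def integrand {N : ℕ} (s : ℂ) (δ : Params N) (r t : ℝ) : ℂ :=
  testFun (r * Complex.exp (Complex.I * t)) δ *
    Complex.exp ((s - 1) * (Real.log r + Complex.I * t))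

/-- The contour integral over the Hankel contour of radius `r`: along `(+∞, r]` with `Arg u = 0`,
counterclockwise along `|u| = r` with `Arg u` from `0` to `2π`, and along `[r, +∞)` with
`Arg u = 2π`. -/
def hankelIntegral {N : ℕ} (r : ℝ) (s : ℂ) (δ : Params N) : ℂ :=
  -(∫ x in Set.Ioi r, integrand s δ x 0) +
    (∫ t in (0 : ℝ)..(2 * Real.pi),
      integrand s δ r t * (r * Complex.I * Complex.exp (Complex.I * t))) +
    ∫ x in Set.Ioi r, integrand s δ x (2 * Real.pi)

/-- Absolute convergence of the three pieces of the Hankel contour integral. -/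
def HankelConverges {N : ℕ} (r : ℝ) (s : ℂ) (δ : Params N) : Prop :=
  MeasureTheory.IntegrableOn (fun x : ℝ => integrand s δ x 0) (Set.Ioi r) ∧
    IntervalIntegrable
      (fun t : ℝ => integrand s δ r t * (r * Complex.I * Complex.exp (Complex.I * t)))
      MeasureTheory.volume 0 (2 * Real.pi) ∧
    MeasureTheory.IntegrableOn (fun x : ℝ => integrand s δ x (2 * Real.pi)) (Set.Ioi r)

/-- The quotient of the Hankel integral by `Γ(s)(e(s) - 1)`, meaningful when `s` is not an
integer. -/
def hankelQuotient {N : ℕ} (ε : Params N → ℝ) (s : ℂ) (δ : Params N) : ℂ :=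
  1 / (Complex.Gamma s * (e s - 1)) * hankelIntegral (ε δ) s δ

open Classical in
/-- `L_{N,ε}(s, δ)`: the quotient off the integers, and its limit (removable singularity) at an
integer `s`. -/
def LEps {N : ℕ} (ε : Params N → ℝ) (s : ℂ) (δ : Params N) : ℂ :=
  if ∃ n : ℤ, s = n then limUnder (𝓝[≠] s) (fun z => hankelQuotient ε z δ)
  else hankelQuotient ε s δ

/-- `Z` is, for the given `θ`, the twisted Barnes zeta function: a function of `(s, w, a)` that is
holomorphic for `s ∉ {1, …, N}` and `(w, a)` in the projection of `TExt N`, and that is the sum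
of the (absolutely convergent) series `∑_m e(m·θ) (w + m·a)^{-s}` when `Re s > N`, `Re w > 0`
and all `Re (a ℓ) > 0`. The domain is connected, so these values are determined by the series. -/
def IsTwistedBarnesZeta (N : ℕ) (θ : Fin N → ℝ) (Z : ℂ × ℂ × (Fin N → ℂ) → ℂ) : Prop :=
  DifferentiableOn ℂ Z ((polePoints N)ᶜ ×ˢ (proj '' TExt N)) ∧
    ∀ (s w : ℂ) (a : Fin N → ℂ), (N : ℝ) < s.re → (w, a, θ) ∈ TPlus N →
      HasSum (fun m : Fin N → ℕ =>
        e (∑ ℓ, (m ℓ : ℂ) * (θ ℓ : ℂ)) * (w + ∑ ℓ, (m ℓ : ℂ) * a ℓ) ^ (-s)) (Z (s, w, a))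

end

end TwistedBarnes

open Filter Topology

namespace TwistedBarnes

open MeasureTheory Set

/-! Three symmetries of `testFun` carry the theorem. Reflection: since `(1 - EX)⁻¹ = -E⁻¹X⁻¹(1 -
E⁻¹X⁻¹)⁻¹`, changing the signs of the `a ℓ` and `θ ℓ` with `ℓ ∈ Λ` and shifting `w` by their trace
only multiplies `testFun` by a constant (`testFun_eq_reflConst_mul`). Applied to the indices with `a
ℓ ∈ -cone`, it brings every parameter of `extDomain` to `w ∈ cone` and each `a ℓ` in `cone` or zero.
A small clockwise rotation then moves `cone` into the open right half-plane, which explains the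
limit `ω → 0⁻`.

Contour deformation: at the resulting parameters, those of `regDomain`, the test function is `O((1 +
x^(-N)) exp(-bx))` on the half-line. The Hankel integral is therefore entire in `s`, independent of
the radius by Cauchy's theorem, and equal to `e(s) - 1` times the half-line integral when `Re s >
N`. Together the two integrals define `regZeta`, holomorphic off `1, …, N`
(`differentiableAt_regZeta`), with poles that are at most simple because `e(s) - 1` has simple
zeros.

Homogeneity: `regZeta` at `M_β δ` is `β^(-s)` times its value at `δ`, by substitution for `β > 0`
and by the identity theorem for complex `β` (`regZeta_MMap`). Hence `exp(iωs) regZeta s (M_{exp(iω)}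
δ)` does not depend on `ω` (`regZeta_rot`). The limit exists and has a closed form at one fixed
angle, from which holomorphy and the pole orders are read off.

For the comparison with the Barnes series, `testFun` is expanded in geometric series and integrated
term by term (`hasSum_regZeta`). Homogeneity continues the sum to the rotated domains, and the
identity theorem, first in `s` and then in a complex rotation angle, shows uniqueness. -/

/-! ### Parameter integrals, multiple series and exponential integrals -/

/-- A holomorphic family of integrands with a locally uniform integrable bound has a holomorphic
integral. -/
theorem differentiableAt_integral_of_bound {E X : Type*} [NormedAddCommGroup E] [NormedSpace ℂ E]
    [FiniteDimensional ℂ E] [MeasurableSpace X] {μ : Measure X} {f : E → X → ℂ} {q₀ : E} {U : Set E}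
    (hU : U ∈ 𝓝 q₀) (hmeas : ∀ q ∈ U, AEStronglyMeasurable (f q) μ)
    (hdiff : ∀ᵐ x ∂μ, ∀ q ∈ U, DifferentiableAt ℂ (fun q => f q x) q) {g : X → ℝ}
    (hg : Integrable g μ) (hb : ∀ᵐ x ∂μ, ∀ q ∈ U, ‖f q x‖ ≤ g x) :
    DifferentiableAt ℂ (fun q => ∫ x, f q x ∂μ) q₀ := by
  obtain ⟨R, hR, hRU⟩ := Metric.mem_nhds_iff.mp hU
  have hq₀ : q₀ ∈ U := mem_of_mem_nhds hU
  -- The bound on the derivative is Cauchy's estimate on a ball of radius `R / 2` inside `U`, where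
  -- `f` moves by at most `2 * g x`.
  refine (hasFDerivAt_integral_of_dominated_of_fderiv_le (𝕜 := ℂ) (s := Metric.ball q₀ (R / 2))
    (F' := fun q x => fderiv ℂ (fun q => f q x) q) (bound := fun x => 2 * g x / (R / 2))
    (Metric.ball_mem_nhds _ (by positivity))
    (by filter_upwards [hU] with q hq using hmeas q hq)
    (Integrable.mono' hg (hmeas _ hq₀) (hb.mono fun x hx => hx _ hq₀)) ?_ ?_ ?_ ?_).differentiableAt
  -- Each directional derivative is a limit of measurable difference quotients; a finite basis
  -- recovers the whole derivative. The shift by `n₀` below keeps the sample points in `U`.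
  · have key : ∀ v : E, AEStronglyMeasurable (fun x => fderiv ℂ (fun q => f q x) q₀ v) μ := by
      intro v
      have hlim : Tendsto (fun n : ℕ => q₀ + ((n : ℂ) + 1)⁻¹ • v) atTop (𝓝 q₀) := by
        have h1 : Tendsto (fun n : ℕ => ((n : ℂ) + 1)⁻¹) atTop (𝓝 0) := by
          have := tendsto_one_div_add_atTop_nhds_zero_nat (𝕜 := ℂ)
          simpa using this
        simpa using (h1.smul_const v).const_add q₀
      obtain ⟨n₀, hn₀⟩ := eventually_atTop.mp (hlim.eventually hU)
      refine aestronglyMeasurable_of_tendsto_ae (u := atTop)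
        (f := fun (n : ℕ) x => (((n + n₀ : ℕ) : ℂ) + 1) •
          (f (q₀ + (((n + n₀ : ℕ) : ℂ) + 1)⁻¹ • v) x - f q₀ x)) ?_ ?_
      · intro n
        exact ((hmeas _ (hn₀ (n + n₀) (by omega))).sub (hmeas _ hq₀)).const_smul (((n + n₀ : ℕ) : ℂ) + 1)
      · filter_upwards [hdiff] with x hx
        have hd := (hx q₀ hq₀).hasFDerivAt
        have hnorm : Tendsto (fun n : ℕ => ‖((((n + n₀ : ℕ) : ℂ) + 1))‖) atTop atTop := by
          have h3 : ∀ n : ℕ, ‖((((n + n₀ : ℕ) : ℂ) + 1))‖ = (n : ℝ) + (n₀ + 1) := by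
            intro n
            rw [show ((((n + n₀ : ℕ) : ℂ) + 1)) = (((n : ℝ) + (n₀ + 1) : ℝ) : ℂ) by push_cast; ring,
              Complex.norm_of_nonneg (by positivity)]
          simp only [h3]
          exact tendsto_atTop_add_const_right _ _ tendsto_natCast_atTop_atTop
        exact hd.lim v hnorm
    have hsum : ∀ L : E →L[ℂ] ℂ, L = ∑ i, L (Module.finBasis ℂ E i) •
        LinearMap.toContinuousLinearMap ((Module.finBasis ℂ E).coord i) := by
      intro L
      apply ContinuousLinearMap.coe_injective
      refine (Module.finBasis ℂ E).ext fun j => ?_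
      simp [Finsupp.single_apply]
    have : (fun x => fderiv ℂ (fun q => f q x) q₀) = fun x => ∑ i,
        (fderiv ℂ (fun q => f q x) q₀) (Module.finBasis ℂ E i) •
        LinearMap.toContinuousLinearMap ((Module.finBasis ℂ E).coord i) := by
      ext1 x
      exact hsum _
    rw [this]
    exact Finset.aestronglyMeasurable_fun_sum _ fun i _ => (key _).smul_const _
  · filter_upwards [hdiff, hb] with x hx hbx q hq
    have hsub : Metric.ball q (R / 2) ⊆ U := fun y hy => hRU <| by
      have := dist_triangle y q q₀
      simp only [Metric.mem_ball] at *
      linarith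
    refine Complex.norm_fderiv_le_div_of_mapsTo_ball
      (fun y hy => (hx y (hsub hy)).differentiableWithinAt) ?_ (by positivity)
    intro y hy
    rw [mem_closedBall_iff_norm]
    have h1 := hbx y (hsub hy)
    have h2 := hbx q (hsub (Metric.mem_ball_self (by positivity)))
    have := norm_sub_le (f y x) (f q x)
    linarith
  · exact (hg.const_mul 2).div_const _
  · filter_upwards [hdiff] with x hx q hq
    refine (hx q (hRU ?_)).hasFDerivAt
    exact Metric.ball_subset_ball (by linarith) hq

/-- A finite product of absolutely convergent series is an absolutely convergent multiple series. -/
theorem summable_norm_and_hasSum_prod {N : ℕ} (f : Fin N → ℕ → ℂ)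
    (hf : ∀ ℓ, Summable fun k => ‖f ℓ k‖) :
    (Summable fun m : Fin N → ℕ => ‖∏ ℓ, f ℓ (m ℓ)‖) ∧
      HasSum (fun m : Fin N → ℕ => ∏ ℓ, f ℓ (m ℓ)) (∏ ℓ, ∑' k, f ℓ k) := by
  induction N with
  | zero => exact ⟨(hasSum_fintype _).summable, by simp⟩
  | succ n ih =>
    obtain ⟨h1, h2⟩ := ih (fun ℓ => f ℓ.succ) (fun ℓ => hf _)
    have gen : ∀ (u : ℕ → ℂ) (v : (Fin n → ℕ) → ℂ) (B : ℂ), (Summable fun k => ‖u k‖) →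
        (Summable fun m => ‖v m‖) → HasSum v B →
        (Summable fun p : ℕ × (Fin n → ℕ) => ‖u p.1 * v p.2‖) ∧
          HasSum (fun p : ℕ × (Fin n → ℕ) => u p.1 * v p.2) ((∑' k, u k) * B) := by
      intro u v B hu hv hB
      have hs := Summable.mul_norm (R := ℂ) hu hv
      exact ⟨hs, hu.of_norm.hasSum.mul hB hs.of_norm⟩
    obtain ⟨hs, hh⟩ := gen (f 0) (fun m => ∏ ℓ : Fin n, f ℓ.succ (m ℓ)) _ (hf 0) h1 h2
    obtain ⟨c, hc⟩ : ∃ c : ℕ × (Fin n → ℕ) ≃ (Fin (n + 1) → ℕ), ∀ p, c p = Fin.cons p.1 p.2 :=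
      ⟨⟨fun p => Fin.cons p.1 p.2, fun m => (m 0, fun i => m i.succ), fun p => by simp,
        fun m => Fin.cons_self_tail m⟩, fun _ => rfl⟩
    have hc' : ∀ p, ∏ ℓ, f ℓ (c p ℓ) = f 0 p.1 * ∏ ℓ : Fin n, f ℓ.succ (p.2 ℓ) := fun p => by
      simp only [hc, Fin.prod_univ_succ, Fin.cons_zero, Fin.cons_succ]
    constructor
    · refine c.summable_iff.mp (hs.congr fun p => ?_)
      simp only [Function.comp_apply, hc']
    · refine c.hasSum_iff.mp ?_
      rw [Fin.prod_univ_succ]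
      have h3 : (fun m : Fin (n + 1) → ℕ => ∏ ℓ, f ℓ (m ℓ)) ∘ c =
          fun p => f 0 p.1 * ∏ ℓ : Fin n, f ℓ.succ (p.2 ℓ) := funext hc'
      rw [h3]
      exact hh

theorem integrableOn_rpow_mul_exp_neg {p b r : ℝ} (hb : 0 < b) (hr : 0 < r ∨ (0 ≤ r ∧ -1 < p)) :
    IntegrableOn (fun x : ℝ => x ^ p * Real.exp (-(b * x))) (Ioi r) := by
  rcases hr with hr | ⟨hr, hp⟩
  · refine integrable_of_isBigO_exp_neg (b := b / 2) (by positivity) ?_ ?_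
    · intro x hx
      have hx0 : x ≠ 0 := (lt_of_lt_of_le hr hx).ne'
      exact ((Real.continuousAt_rpow_const _ _ (Or.inl hx0)).mul (by fun_prop)).continuousWithinAt
    · have h1 := (isLittleO_rpow_exp_pos_mul_atTop p (half_pos hb)).isBigO
      have h2 := h1.mul (Asymptotics.isBigO_refl (fun x : ℝ => Real.exp (-(b * x))) atTop)
      refine h2.congr_right fun x => ?_
      rw [← Real.exp_add]
      congr 1
      ring
  · have := integrableOn_rpow_mul_exp_neg_mul_rpow hp one_pos hb
    refine (this.mono_set (Ioi_subset_Ioi hr)).congr_fun (fun x _ => ?_) measurableSet_Ioi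
    simp [neg_mul]

/-! ### Bounds for the test function -/

theorem norm_e_ofReal (θ : ℝ) : ‖e (θ : ℂ)‖ = 1 := by
  rw [e, show (2 * Real.pi * Complex.I * (θ : ℂ)) = ((2 * Real.pi * θ : ℝ) : ℂ) * Complex.I by
    push_cast; ring, Complex.norm_exp_ofReal_mul_I]

theorem e_ne_zero (z : ℂ) : e z ≠ 0 := Complex.exp_ne_zero _

theorem e_eq_one_iff (z : ℂ) : e z = 1 ↔ ∃ n : ℤ, z = n := by
  rw [e, Complex.exp_eq_one_iff]
  refine exists_congr fun n => ?_
  rw [mul_comm (2 * (Real.pi : ℂ) * Complex.I)]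
  exact mul_left_inj' Complex.two_pi_I_ne_zero

theorem e_ofReal_eq_one_iff (θ : ℝ) : e (θ : ℂ) = 1 ↔ ∃ n : ℤ, θ = n := by
  rw [e_eq_one_iff]
  exact exists_congr fun n => by exact_mod_cast Iff.rfl

/-- The factor `1 - e(θ) exp(-z)` vanishes at most to first order at `z = 0`. -/
theorem exists_norm_factor_ge (θ : ℝ) : ∃ ρ > 0, ∃ c > 0, ∀ z : ℂ, ‖z‖ ≤ ρ →
    c * ‖z‖ ≤ ‖1 - e θ * Complex.exp (-z)‖ := by
  -- If `e θ = 1` there is a simple zero, and the quadratic error costs at most half of `‖z‖` when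
  -- `‖z‖ ≤ 1 / 2`. Otherwise the factor stays away from `0` by continuity.
  by_cases h : e (θ : ℂ) = 1
  · refine ⟨1 / 2, by norm_num, 1 / 2, by norm_num, fun z hz => ?_⟩
    have h1 := Complex.norm_exp_sub_one_sub_id_le (x := -z) (by rw [norm_neg]; linarith)
    have h2 : ‖z‖ ≤ ‖Complex.exp (-z) - 1 - -z‖ + ‖1 - e θ * Complex.exp (-z)‖ := by
      have : z = (Complex.exp (-z) - 1 - -z) + (1 - e θ * Complex.exp (-z)) := by rw [h]; ring
      calc ‖z‖ = ‖(Complex.exp (-z) - 1 - -z) + (1 - e θ * Complex.exp (-z))‖ := by rw [← this]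
        _ ≤ _ := norm_add_le _ _
    rw [norm_neg] at h1
    nlinarith [norm_nonneg z]
  · have hpos : 0 < ‖1 - e (θ : ℂ)‖ := norm_pos_iff.mpr (sub_ne_zero.mpr (Ne.symm h))
    have hc : ContinuousAt (fun z : ℂ => ‖1 - e θ * Complex.exp (-z)‖) 0 := by fun_prop
    have h0 : (fun z : ℂ => ‖1 - e θ * Complex.exp (-z)‖) 0 > ‖1 - e (θ : ℂ)‖ / 2 := by
      simpa using hpos
    obtain ⟨d, hd, hdd⟩ := Metric.eventually_nhds_iff.mp (hc.eventually (lt_mem_nhds h0))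
    refine ⟨min 1 (d / 2), by positivity, ‖1 - e (θ : ℂ)‖ / 2, by positivity, fun z hz => ?_⟩
    have h1 : ‖z‖ ≤ 1 := hz.trans (min_le_left _ _)
    have h2 : ‖z‖ < d := by
      have := hz.trans (min_le_right _ _)
      linarith
    have h3 := hdd (y := z) (by simpa using h2)
    calc ‖1 - e (θ : ℂ)‖ / 2 * ‖z‖ ≤ ‖1 - e (θ : ℂ)‖ / 2 * 1 := by gcongr
      _ ≤ _ := by rw [mul_one]; exact h3.le

/-- The exponential term has norm at most `exp(-xb) ≤ (1 + xb)⁻¹`. -/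
theorem norm_factor_ge {θ x b : ℝ} {a : ℂ} (hx : 0 < x) (hb : 0 < b) (ha : b ≤ a.re) :
    0 < x * b / (1 + x * b) ∧ x * b / (1 + x * b) ≤ ‖1 - e θ * Complex.exp (-(x * a))‖ := by
  have hxb : 0 < x * b := by positivity
  refine ⟨by positivity, ?_⟩
  have h1 : ‖e (θ : ℂ) * Complex.exp (-(x * a))‖ ≤ (1 + x * b)⁻¹ := by
    rw [norm_mul, norm_e_ofReal, one_mul, Complex.norm_exp]
    have : (-((x : ℂ) * a)).re = -(x * a.re) := by simp
    rw [this, Real.exp_neg]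
    refine inv_anti₀ (by positivity) ?_
    have := Real.add_one_le_exp (x * a.re)
    nlinarith
  have h2 := norm_sub_norm_le (1 : ℂ) (e θ * Complex.exp (-(x * a)))
  rw [norm_one] at h2
  have h3 : x * b / (1 + x * b) = 1 - (1 + x * b)⁻¹ := by field_simp; ring
  linarith

/-- Stating the bounds for all small `r`, and then all large `C`, lets finitely many indices share
the same `r` and `C`. -/
theorem factor_bound (θ b M : ℝ) (hb : 0 < b) : ∀ᶠ r in 𝓝[>] (0 : ℝ), ∀ᶠ C in atTop, ∀ a : ℂ,
    ((a = 0 ∧ e (θ : ℂ) ≠ 1) ∨ (b ≤ a.re ∧ ‖a‖ ≤ M)) →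
    (∀ x : ℝ, 0 < x → ‖(1 - e θ * Complex.exp (-(x * a)))⁻¹‖ ≤ C * (1 + 1 / x)) ∧
    ∀ u : ℂ, 0 < ‖u‖ → ‖u‖ ≤ r → 1 - e θ * Complex.exp (-(u * a)) ≠ 0 ∧
      ‖(1 - e θ * Complex.exp (-(u * a)))⁻¹‖ ≤ C / ‖u‖ := by
  obtain ⟨ρ, hρ, c, hc, hcρ⟩ := exists_norm_factor_ge θ
  have hM : 0 < |M| + 1 := by positivity
  have hr₀ : 0 < min 1 (ρ / (|M| + 1)) := by positivity
  filter_upwards [Ioo_mem_nhdsGT hr₀] with r hr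
  filter_upwards [eventually_ge_atTop ‖(1 - e (θ : ℂ))⁻¹‖, eventually_ge_atTop (1 : ℝ),
    eventually_ge_atTop (1 / b), eventually_ge_atTop (1 / (c * b))] with C h1 h2 h3 h4
  have hC : 0 < C := by linarith
  rintro a (⟨rfl, ha⟩ | ⟨ha, haM⟩)
  · simp only [mul_zero, neg_zero, Complex.exp_zero, mul_one]
    refine ⟨fun x hx => h1.trans ?_, fun u hu hur => ⟨sub_ne_zero.mpr ha.symm, h1.trans ?_⟩⟩
    · have : 0 < 1 / x := by positivity
      nlinarith
    · rw [le_div_iff₀ hu]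
      have : ‖u‖ ≤ 1 := hur.trans (hr.2.le.trans (min_le_left _ _))
      nlinarith
  · refine ⟨fun x hx => ?_, fun u hu hur => ?_⟩
    · obtain ⟨h5, h6⟩ := norm_factor_ge (θ := θ) hx hb ha
      rw [norm_inv]
      refine (inv_anti₀ h5 h6).trans ?_
      have h7 : (x * b / (1 + x * b))⁻¹ = 1 + 1 / b * (1 / x) := by field_simp; ring
      rw [h7]
      have : 0 < 1 / x := by positivity
      nlinarith
    · have h5 : b ≤ ‖a‖ := ha.trans (Complex.re_le_norm a)
      have h6 : ‖u * a‖ ≤ ρ := by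
        rw [norm_mul]
        have h8 : ‖u‖ ≤ ρ / (|M| + 1) := hur.trans (hr.2.le.trans (min_le_right _ _))
        have h9 : ‖a‖ ≤ |M| + 1 := haM.trans ((le_abs_self M).trans (by linarith))
        calc ‖u‖ * ‖a‖ ≤ ρ / (|M| + 1) * (|M| + 1) := by gcongr
          _ = ρ := by field_simp
      have h7 : c * b * ‖u‖ ≤ ‖1 - e θ * Complex.exp (-(u * a))‖ := by
        refine le_trans ?_ (hcρ _ h6)
        rw [norm_mul]
        have : 0 < c * ‖u‖ := by positivity
        nlinarith
      have h8 : 0 < c * b * ‖u‖ := by positivity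
      refine ⟨norm_pos_iff.mp (h8.trans_le h7), ?_⟩
      rw [norm_inv]
      refine (inv_anti₀ h8 h7).trans ?_
      rw [mul_inv, ← div_eq_mul_inv, ← one_div]
      gcongr

/-- A box of parameters on which the test function is uniformly bounded. -/
def paramBox {N : ℕ} (θ : Fin N → ℝ) (b M : ℝ) : Set (Params N) :=
  {δ | δ.2.2 = θ ∧ b ≤ δ.1.re ∧ ‖δ.1‖ ≤ M ∧
    ∀ ℓ, (δ.2.1 ℓ = 0 ∧ e (θ ℓ : ℂ) ≠ 1) ∨ (b ≤ (δ.2.1 ℓ).re ∧ ‖δ.2.1 ℓ‖ ≤ M)}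

theorem exists_testFun_bound {N : ℕ} (θ : Fin N → ℝ) (b M : ℝ) (hb : 0 < b) :
    ∃ r > 0, ∃ C > 0, ∀ δ ∈ paramBox θ b M,
      (∀ x : ℝ, 0 < x →
        ‖testFun x δ‖ ≤ C * (1 + x ^ (-N : ℝ)) * Real.exp (-(b * x))) ∧
      ∀ u : ℂ, 0 < ‖u‖ → ‖u‖ ≤ r →
        (∀ ℓ, 1 - e (δ.2.2 ℓ) * Complex.exp (-(u * δ.2.1 ℓ)) ≠ 0) ∧
        ‖testFun u δ‖ ≤ C * ‖u‖ ^ (-N : ℝ) := by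
  have h := eventually_all.mpr fun ℓ => factor_bound (θ ℓ) b M hb
  obtain ⟨r, hr, hr0⟩ := (h.and self_mem_nhdsWithin).exists
  have hr0 : 0 < r := hr0
  obtain ⟨C, hC, hC0⟩ := ((eventually_all.mpr hr).and (eventually_gt_atTop (0 : ℝ))).exists
  -- One constant for both bounds: `2 ^ (N - 1)` comes from `(1 + y)^N ≤ 2^(N-1) (1 + y^N)` with `y
  -- = 1/x`, and `exp(r|M|)` bounds `exp(-uw)` for `‖u‖ ≤ r`.
  refine ⟨r, hr0, C ^ N * (2 ^ (N - 1) + Real.exp (r * |M|)), by positivity, ?_⟩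
  rintro ⟨w, a, θ'⟩ ⟨rfl, hw, hwM, ha⟩
  dsimp only at *
  refine ⟨fun x hx => ?_, fun u hu hur => ⟨fun ℓ => ((hC ℓ _ (ha ℓ)).2 u hu hur).1, ?_⟩⟩
  · rw [testFun, norm_mul, norm_prod]
    have h1 : ‖Complex.exp (-(x * w))‖ ≤ Real.exp (-(b * x)) := by
      rw [Complex.norm_exp, Real.exp_le_exp]
      simp only [Complex.neg_re, Complex.mul_re, Complex.ofReal_re, Complex.ofReal_im]
      nlinarith
    have h2 : ∏ ℓ, ‖(1 - e (θ' ℓ) * Complex.exp (-(x * a ℓ)))⁻¹‖ ≤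
        C ^ N * (2 ^ (N - 1) * (1 + x ^ (-N : ℝ))) := by
      calc _ ≤ ∏ ℓ : Fin N, C * (1 + 1 / x) :=
            Finset.prod_le_prod (fun _ _ => norm_nonneg _) fun ℓ _ => (hC ℓ _ (ha ℓ)).1 x hx
        _ = C ^ N * (1 + 1 / x) ^ N := by simp [mul_pow]
        _ ≤ _ := by
          gcongr
          refine (add_pow_le zero_le_one (by positivity) N).trans_eq ?_
          rw [one_pow, Real.rpow_neg hx.le, Real.rpow_natCast, one_div, inv_pow]
    calc _ ≤ Real.exp (-(b * x)) * (C ^ N * (2 ^ (N - 1) * (1 + x ^ (-N : ℝ)))) := by gcongr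
      _ = C ^ N * 2 ^ (N - 1) * (1 + x ^ (-N : ℝ)) * Real.exp (-(b * x)) := by ring
      _ ≤ _ := by
        gcongr
        linarith [Real.exp_pos (r * |M|)]
  · rw [testFun, norm_mul, norm_prod]
    have h1 : ‖Complex.exp (-(u * w))‖ ≤ Real.exp (r * |M|) := by
      rw [Complex.norm_exp, Real.exp_le_exp]
      calc (-(u * w)).re ≤ ‖-(u * w)‖ := Complex.re_le_norm _
        _ = ‖u‖ * ‖w‖ := by rw [norm_neg, norm_mul]
        _ ≤ _ := by
          gcongr
          exact hwM.trans (le_abs_self M)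
    have h2 : ∏ ℓ, ‖(1 - e (θ' ℓ) * Complex.exp (-(u * a ℓ)))⁻¹‖ ≤ C ^ N * ‖u‖ ^ (-N : ℝ) := by
      calc _ ≤ ∏ ℓ : Fin N, C / ‖u‖ :=
            Finset.prod_le_prod (fun _ _ => norm_nonneg _)
              fun ℓ _ => ((hC ℓ _ (ha ℓ)).2 u hu hur).2
        _ = C ^ N * ‖u‖ ^ (-N : ℝ) := by
          rw [Real.rpow_neg hu.le, Real.rpow_natCast]
          simp [mul_pow, div_eq_mul_inv]
    calc _ ≤ Real.exp (r * |M|) * (C ^ N * ‖u‖ ^ (-N : ℝ)) := by gcongr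
      _ = C ^ N * Real.exp (r * |M|) * ‖u‖ ^ (-N : ℝ) := by ring
      _ ≤ _ := by
        gcongr
        linarith [pow_pos (zero_lt_two (α := ℝ)) (N - 1)]

/-! ### Regular parameters and admissible radii -/

/-- The parameters for which the half-line integral converges, without reflection. -/
def regDomain (N : ℕ) : Set (Params N) :=
  {δ | 0 < δ.1.re ∧ ∀ ℓ, (δ.2.1 ℓ = 0 ∧ e (δ.2.2 ℓ : ℂ) ≠ 1) ∨ 0 < (δ.2.1 ℓ).re}

/-- The denominators of the test function do not vanish at `u`. -/
def NonPole {N : ℕ} (u : ℂ) (δ : Params N) : Prop :=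
  ∀ ℓ, 1 - e (δ.2.2 ℓ) * Complex.exp (-(u * δ.2.1 ℓ)) ≠ 0

/-- The circle radii up to which the test function has no pole, apart from `0`. -/
def Admissible {N : ℕ} (r : ℝ) (δ : Params N) : Prop :=
  0 < r ∧ ∀ u : ℂ, 0 < ‖u‖ → ‖u‖ ≤ r → NonPole u δ

theorem nonPole_iff {N : ℕ} (u : ℂ) (δ : Params N) :
    NonPole u δ ↔ ∀ ℓ, e (δ.2.2 ℓ) ≠ Complex.exp (u * δ.2.1 ℓ) := by
  refine forall_congr' fun ℓ => not_congr ?_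
  rw [sub_eq_zero, Complex.exp_neg, eq_comm, mul_inv_eq_one₀ (Complex.exp_ne_zero _)]

theorem admissible_of_mem_radii {N : ℕ} {ε : Params N → ℝ} (hε : ε ∈ radii N) {δ : Params N}
    (hδ : δ ∈ goodDomain N) : Admissible (ε δ) δ :=
  ⟨(hε δ hδ).1, fun u hu hur => (nonPole_iff u δ).mpr fun ℓ => (hε δ hδ).2 ℓ u hu hur⟩

theorem nonPole_ofReal {N : ℕ} {δ : Params N} (hδ : δ ∈ regDomain N) {x : ℝ} (hx : 0 < x) :
    NonPole (x : ℂ) δ := by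
  intro ℓ
  rcases hδ.2 ℓ with ⟨h0, h1⟩ | h
  · rw [h0]
    simpa [sub_eq_zero] using h1.symm
  · obtain ⟨h1, h2⟩ := norm_factor_ge (θ := δ.2.2 ℓ) hx h le_rfl
    exact norm_pos_iff.mp (h1.trans_le h2)

theorem exists_mem_paramBox {N : ℕ} {δ : Params N} (hδ : δ ∈ regDomain N) :
    ∃ b > 0, ∃ M, δ ∈ paramBox δ.2.2 b M := by
  have h : ∀ ℓ, ∀ᶠ b in 𝓝[>] (0 : ℝ), ∀ᶠ M in atTop,
      (δ.2.1 ℓ = 0 ∧ e (δ.2.2 ℓ : ℂ) ≠ 1) ∨ (b ≤ (δ.2.1 ℓ).re ∧ ‖δ.2.1 ℓ‖ ≤ M) := by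
    intro ℓ
    rcases hδ.2 ℓ with h | h
    · exact .of_forall fun _ => .of_forall fun _ => Or.inl h
    · filter_upwards [Ioo_mem_nhdsGT h] with b hb
      filter_upwards [eventually_ge_atTop ‖δ.2.1 ℓ‖] with M hM
      exact Or.inr ⟨hb.2.le, hM⟩
  obtain ⟨b, hb, hb0⟩ := ((eventually_all.mpr h).and (Ioo_mem_nhdsGT hδ.1)).exists
  obtain ⟨M, hM, hM0⟩ := ((eventually_all.mpr hb).and (eventually_ge_atTop ‖δ.1‖)).exists
  exact ⟨b, hb0.1, M, rfl, hb0.2.le, hM0, hM⟩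

theorem regDomain_subset_goodDomain {N : ℕ} : regDomain N ⊆ goodDomain N := by
  intro δ hδ ℓ h0 n hn
  rcases hδ.2 ℓ with ⟨_, h⟩ | h
  · exact h ((e_ofReal_eq_one_iff _).mpr ⟨n, hn⟩)
  · simp [h0] at h

/-- A factor with `a ℓ = 0` is a nonzero constant; any other factor has a zero-free punctured disc
by the linear lower bound at the origin. -/
theorem radii_nonempty (N : ℕ) : (radii N).Nonempty := by
  have : ∀ δ : Params N, ∃ r : ℝ, δ ∈ goodDomain N → Admissible r δ := by
    intro δ
    by_cases hδ : δ ∈ goodDomain N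
    · have h : ∀ ℓ, ∀ᶠ r in 𝓝[>] (0 : ℝ), ∀ u : ℂ, 0 < ‖u‖ → ‖u‖ ≤ r →
          1 - e (δ.2.2 ℓ) * Complex.exp (-(u * δ.2.1 ℓ)) ≠ 0 := by
        intro ℓ
        by_cases h0 : δ.2.1 ℓ = 0
        · refine .of_forall fun r u _ _ => ?_
          rw [h0, mul_zero, neg_zero, Complex.exp_zero, mul_one, sub_ne_zero]
          intro h1
          obtain ⟨n, hn⟩ := (e_ofReal_eq_one_iff _).mp h1.symm
          exact hδ ℓ h0 n hn
        · obtain ⟨ρ, hρ, c, hc, hcρ⟩ := exists_norm_factor_ge (δ.2.2 ℓ)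
          have ha : 0 < ‖δ.2.1 ℓ‖ := norm_pos_iff.mpr h0
          filter_upwards [Ioo_mem_nhdsGT (div_pos hρ ha)] with r hr u hu hur
          have h1 := hcρ (u * δ.2.1 ℓ) (by
            rw [norm_mul, ← le_div_iff₀ ha]
            exact hur.trans hr.2.le)
          refine norm_pos_iff.mp (lt_of_lt_of_le ?_ h1)
          rw [norm_mul]
          positivity
      obtain ⟨r, hr, hr0⟩ := ((eventually_all.mpr h).and self_mem_nhdsWithin).exists
      exact ⟨r, fun _ => ⟨hr0, fun u hu hur ℓ => hr ℓ u hu hur⟩⟩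
    · exact ⟨1, fun h => absurd h hδ⟩
  choose ε hε using this
  refine ⟨ε, fun δ hδ => ⟨(hε δ hδ).1, fun ℓ u hu hur => ?_⟩⟩
  exact (nonPole_iff u δ).mp ((hε δ hδ).2 u hu hur) ℓ

/-! ### Convergence and holomorphy of the Hankel integral -/

/-- The integral of `F(x, δ) x^{s-1}` along `(r, ∞)`. -/
noncomputable def rayIntegral {N : ℕ} (r : ℝ) (s : ℂ) (δ : Params N) : ℂ :=
  ∫ x in Ioi r, testFun (x : ℂ) δ * Complex.exp ((s - 1) * Real.log x)

/-- The circular part of the Hankel integral. -/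
noncomputable def circleIntegral {N : ℕ} (r : ℝ) (s : ℂ) (δ : Params N) : ℂ :=
  ∫ t in (0 : ℝ)..(2 * Real.pi),
    integrand s δ r t * (r * Complex.I * Complex.exp (Complex.I * t))

theorem integrand_zero {N : ℕ} (s : ℂ) (δ : Params N) (x : ℝ) :
    integrand s δ x 0 = testFun (x : ℂ) δ * Complex.exp ((s - 1) * Real.log x) := by
  simp [integrand]

theorem integrand_two_pi {N : ℕ} (s : ℂ) (δ : Params N) (x : ℝ) :
    integrand s δ x (2 * Real.pi) =
      e s * (testFun (x : ℂ) δ * Complex.exp ((s - 1) * Real.log x)) := by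
  have h1 : Complex.exp (Complex.I * ((2 * Real.pi : ℝ) : ℂ)) = 1 := by
    rw [mul_comm]
    push_cast
    exact Complex.exp_two_pi_mul_I
  have h2 : Complex.exp ((s - 1) * (Real.log x + Complex.I * ((2 * Real.pi : ℝ) : ℂ))) =
      e s * Complex.exp ((s - 1) * Real.log x) := by
    rw [mul_add, Complex.exp_add, mul_comm]
    congr 1
    rw [e, sub_mul, Complex.exp_sub, one_mul, h1, div_one]
    congr 1
    push_cast
    ring
  rw [integrand, h1, h2, mul_one]
  ring

/-- Going once around the origin multiplies `u^(s-1)` by `e(s)`, so the two rays differ only by this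
factor and the orientation. -/
theorem hankelIntegral_eq {N : ℕ} (r : ℝ) (s : ℂ) (δ : Params N) :
    hankelIntegral r s δ = (e s - 1) * rayIntegral r s δ + circleIntegral r s δ := by
  rw [hankelIntegral, circleIntegral, rayIntegral]
  simp only [integrand_zero, integrand_two_pi, integral_const_mul]
  ring

/-- The majorant of the integrand along the half-line. -/
noncomputable def rayBound (N : ℕ) (C b σ₀ σ₁ x : ℝ) : ℝ :=
  C * (1 + x ^ (-N : ℝ)) * Real.exp (-(b * x)) * (x ^ (σ₀ - 1) + x ^ (σ₁ - 1))

theorem integrableOn_rayBound {N : ℕ} {C b σ₀ σ₁ r : ℝ} (hb : 0 < b)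
    (hr : 0 < r ∨ (0 ≤ r ∧ N < σ₀ ∧ N < σ₁)) : IntegrableOn (rayBound N C b σ₀ σ₁) (Ioi r) := by
  have hr0 : 0 ≤ r := by rcases hr with h | h; exacts [h.le, h.1]
  have hN : (0 : ℝ) ≤ N := Nat.cast_nonneg N
  have key : ∀ p : ℝ, (p = σ₀ ∨ p = σ₁) →
      IntegrableOn (fun x : ℝ => C * (x ^ (p - 1) * Real.exp (-(b * x)) +
        x ^ (p - 1 - N) * Real.exp (-(b * x)))) (Ioi r) := by
    intro p hp
    refine ((integrableOn_rpow_mul_exp_neg hb ?_).add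
      (integrableOn_rpow_mul_exp_neg hb ?_)).const_mul C
    all_goals
      rcases hr with h | ⟨h, h0, h1⟩
      · exact Or.inl h
      · refine Or.inr ⟨h, ?_⟩
        rcases hp with rfl | rfl <;> linarith
  refine ((key σ₀ (Or.inl rfl)).add (key σ₁ (Or.inr rfl))).congr_fun (fun x hx => ?_)
    measurableSet_Ioi
  have hx : 0 < x := lt_of_le_of_lt hr0 hx
  have hs : ∀ p : ℝ, x ^ (p - 1 - N) = x ^ (p - 1) * x ^ (-N : ℝ) := fun p => by
    rw [← Real.rpow_add hx, ← sub_eq_add_neg]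
  simp only [Pi.add_apply, rayBound, hs]
  ring

theorem norm_exp_mul_log {s : ℂ} {x : ℝ} (hx : 0 < x) :
    ‖Complex.exp ((s - 1) * Real.log x)‖ = x ^ (s.re - 1) := by
  rw [Complex.norm_exp, Real.rpow_def_of_pos hx]
  congr 1
  simp [mul_comm]

/-- Yields one majorant for all `Re s` in `[σ₀, σ₁]`: the larger exponent governs `x ≥ 1`, the
smaller one `x ≤ 1`. -/
theorem rpow_le_add {x σ₀ σ σ₁ : ℝ} (hx : 0 < x) (h0 : σ₀ ≤ σ) (h1 : σ ≤ σ₁) :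
    x ^ (σ - 1) ≤ x ^ (σ₀ - 1) + x ^ (σ₁ - 1) := by
  have p0 := Real.rpow_pos_of_pos hx (σ₀ - 1)
  have p1 := Real.rpow_pos_of_pos hx (σ₁ - 1)
  rcases le_total 1 x with h | h
  · have := Real.rpow_le_rpow_of_exponent_le h (sub_le_sub_right h1 1)
    linarith
  · have := Real.rpow_le_rpow_of_exponent_ge hx h (sub_le_sub_right h0 1)
    linarith

/-- The parameters `(w, a, θ)` where `a ℓ` is replaced by `0` for `ℓ ∈ Z`. -/
def maskParams {N : ℕ} (Z : Finset (Fin N)) (θ : Fin N → ℝ) (q : ℂ × (Fin N → ℂ)) : Params N :=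
  (q.1, fun ℓ => if ℓ ∈ Z then 0 else q.2 ℓ, θ)

/-- The open set of `(w, a)` with `Re w > 0` and `Re (a ℓ) > 0` for `ℓ ∉ Z`. -/
def maskDomain {N : ℕ} (Z : Finset (Fin N)) : Set (ℂ × (Fin N → ℂ)) :=
  {q | 0 < q.1.re ∧ ∀ ℓ, ℓ ∉ Z → 0 < (q.2 ℓ).re}

theorem isOpen_maskDomain {N : ℕ} (Z : Finset (Fin N)) : IsOpen (maskDomain Z) := by
  have : maskDomain Z = {q : ℂ × (Fin N → ℂ) | 0 < q.1.re} ∩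
      ⋂ ℓ : Fin N, ⋂ _ : ℓ ∉ Z, {q : ℂ × (Fin N → ℂ) | 0 < (q.2 ℓ).re} := by
    ext q; simp [maskDomain]
  rw [this]
  refine (isOpen_lt (by fun_prop) (by fun_prop)).inter
    (isOpen_iInter_of_finite fun ℓ => isOpen_iInter_of_finite fun _ =>
      isOpen_lt (by fun_prop) (by fun_prop))

/-- `regDomain` is not open at a parameter with some `a ℓ = 0`. Freezing such coordinates at `0`
leaves the others free in an open set, on which holomorphy makes sense. -/
theorem maskParams_mem_regDomain {N : ℕ} {Z : Finset (Fin N)} {θ : Fin N → ℝ}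
    (hZ : ∀ ℓ ∈ Z, e (θ ℓ : ℂ) ≠ 1) {q : ℂ × (Fin N → ℂ)} (hq : q ∈ maskDomain Z) :
    maskParams Z θ q ∈ regDomain N := by
  refine ⟨hq.1, fun ℓ => ?_⟩
  by_cases h : ℓ ∈ Z
  · exact Or.inl ⟨by simp [maskParams, h], hZ ℓ h⟩
  · exact Or.inr (by simpa [maskParams, h] using hq.2 ℓ h)

theorem eventually_mem_paramBox {N : ℕ} {Z : Finset (Fin N)} {θ : Fin N → ℝ}
    (hZ : ∀ ℓ ∈ Z, e (θ ℓ : ℂ) ≠ 1) {q₀ : ℂ × (Fin N → ℂ)} (hq : q₀ ∈ maskDomain Z) :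
    ∃ b > 0, ∃ M, ∀ᶠ q in 𝓝 q₀, maskParams Z θ q ∈ paramBox θ b M := by
  obtain ⟨b, hb, M, -, h1, h2, h3⟩ := exists_mem_paramBox (maskParams_mem_regDomain hZ hq)
  refine ⟨b / 2, half_pos hb, M + 1, ?_⟩
  have c1 : ∀ᶠ q : ℂ × (Fin N → ℂ) in 𝓝 q₀, b / 2 < q.1.re :=
    (by fun_prop : ContinuousAt (fun q : ℂ × (Fin N → ℂ) => q.1.re) q₀).eventually
      (lt_mem_nhds (by have : b ≤ q₀.1.re := h1; linarith))
  have c2 : ∀ᶠ q : ℂ × (Fin N → ℂ) in 𝓝 q₀, ‖q.1‖ < M + 1 :=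
    (by fun_prop : ContinuousAt (fun q : ℂ × (Fin N → ℂ) => ‖q.1‖) q₀).eventually
      (gt_mem_nhds (by have : ‖q₀.1‖ ≤ M := h2; linarith))
  have c3 : ∀ᶠ q : ℂ × (Fin N → ℂ) in 𝓝 q₀, ∀ ℓ, ℓ ∉ Z →
      b / 2 < (q.2 ℓ).re ∧ ‖q.2 ℓ‖ < M + 1 := by
    rw [eventually_all]
    intro ℓ
    rw [eventually_imp_distrib_left]
    intro hℓ
    have h4 : b ≤ (q₀.2 ℓ).re ∧ ‖q₀.2 ℓ‖ ≤ M := by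
      rcases h3 ℓ with ⟨h4, -⟩ | h4
      · have := hq.2 ℓ hℓ
        simp only [maskParams, if_neg hℓ] at h4
        simp [h4] at this
      · simpa only [maskParams, if_neg hℓ] using h4
    exact ((by fun_prop : ContinuousAt (fun q : ℂ × (Fin N → ℂ) => (q.2 ℓ).re) q₀).eventually
      (lt_mem_nhds (by linarith))).and
      ((by fun_prop : ContinuousAt (fun q : ℂ × (Fin N → ℂ) => ‖q.2 ℓ‖) q₀).eventually
      (gt_mem_nhds (by linarith)))
  filter_upwards [c1, c2, c3] with q d1 d2 d3
  refine ⟨rfl, d1.le, d2.le, fun ℓ => ?_⟩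
  by_cases h : ℓ ∈ Z
  · exact Or.inl ⟨by simp [maskParams, h], hZ ℓ h⟩
  · exact Or.inr (by simpa only [maskParams, if_neg h] using ⟨(d3 ℓ h).1.le, (d3 ℓ h).2.le⟩)

theorem differentiableAt_prod {ι E : Type*} [NormedAddCommGroup E] [NormedSpace ℂ E] (t : Finset ι)
    {f : ι → E → ℂ} {q : E} (hf : ∀ i, DifferentiableAt ℂ (f i) q) :
    DifferentiableAt ℂ (fun q => ∏ i ∈ t, f i q) q := by
  classical
  induction t using Finset.induction_on with
  | empty => simp
  | insert i t hi ih =>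
    simp only [Finset.prod_insert hi]
    exact (hf i).mul ih

theorem differentiableAt_testFun_maskParams {N : ℕ} {Z : Finset (Fin N)} {θ : Fin N → ℝ} {u : ℂ}
    {q : ℂ × (Fin N → ℂ)} (h : NonPole u (maskParams Z θ q)) :
    DifferentiableAt ℂ (fun q => testFun u (maskParams Z θ q)) q := by
  unfold testFun
  refine DifferentiableAt.mul ?_ ?_
  · simp only [maskParams]
    fun_prop
  · refine differentiableAt_prod _ fun ℓ => DifferentiableAt.fun_inv ?_ (h ℓ)
    by_cases hℓ : ℓ ∈ Z
    · simp [maskParams, hℓ]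
    · simp only [maskParams, if_neg hℓ]
      fun_prop

theorem differentiableAt_testFun {N : ℕ} {δ : Params N} {u : ℂ} (h : NonPole u δ) :
    DifferentiableAt ℂ (fun u => testFun u δ) u := by
  unfold testFun
  refine DifferentiableAt.mul (by fun_prop) ?_
  refine differentiableAt_prod _ fun ℓ => DifferentiableAt.fun_inv ?_ (h ℓ)
  fun_prop

theorem continuousOn_rayIntegrand {N : ℕ} {δ : Params N} (hδ : δ ∈ regDomain N) (s : ℂ) {r : ℝ}
    (hr : 0 ≤ r) : ContinuousOn
      (fun x : ℝ => testFun (x : ℂ) δ * Complex.exp ((s - 1) * Real.log x)) (Ioi r) := by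
  intro x hx
  have hx : 0 < x := lt_of_le_of_lt hr hx
  have h1 : ContinuousAt (fun x : ℝ => testFun (x : ℂ) δ) x :=
    ContinuousAt.comp (f := fun x : ℝ => (x : ℂ)) (g := fun u => testFun u δ)
      (differentiableAt_testFun (nonPole_ofReal hδ hx)).continuousAt (by fun_prop)
  have h2 : ContinuousAt (fun x : ℝ => Real.log x) x := Real.continuousAt_log hx.ne'
  exact (h1.mul (by fun_prop)).continuousWithinAt

theorem integrableOn_rayIntegrand {N : ℕ} {δ : Params N} (hδ : δ ∈ regDomain N) {s : ℂ} {r : ℝ}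
    (hr : 0 < r ∨ (0 ≤ r ∧ N < s.re)) : IntegrableOn
      (fun x : ℝ => testFun (x : ℂ) δ * Complex.exp ((s - 1) * Real.log x)) (Ioi r) := by
  have hr0 : 0 ≤ r := by rcases hr with h | h; exacts [h.le, h.1]
  obtain ⟨b, hb, M, hM⟩ := exists_mem_paramBox hδ
  obtain ⟨r', -, C, hC, hbd⟩ := exists_testFun_bound δ.2.2 b M hb
  refine Integrable.mono' (integrableOn_rayBound (C := C) (b := b) (σ₀ := s.re) (σ₁ := s.re) hb
    (N := N) (by tauto))
    ((continuousOn_rayIntegrand hδ s hr0).aestronglyMeasurable measurableSet_Ioi) ?_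
  filter_upwards [ae_restrict_mem measurableSet_Ioi] with x hx
  have hx : 0 < x := lt_of_le_of_lt hr0 hx
  rw [norm_mul, norm_exp_mul_log hx, rayBound]
  have := (hbd δ hM).1 x hx
  gcongr
  exact rpow_le_add hx le_rfl le_rfl

theorem differentiableAt_rayIntegral {N : ℕ} {Z : Finset (Fin N)} {θ : Fin N → ℝ}
    (hZ : ∀ ℓ ∈ Z, e (θ ℓ : ℂ) ≠ 1) {p : ℂ × ℂ × (Fin N → ℂ)} (hq : p.2 ∈ maskDomain Z) {r : ℝ}
    (hr : 0 < r ∨ (0 ≤ r ∧ N < p.1.re)) :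
    DifferentiableAt ℂ (fun p : ℂ × ℂ × (Fin N → ℂ) => rayIntegral r p.1 (maskParams Z θ p.2)) p := by
  have hr0 : 0 ≤ r := by rcases hr with h | h; exacts [h.le, h.1]
  obtain ⟨b, hb, M, hM⟩ := eventually_mem_paramBox hZ hq
  obtain ⟨r', -, C, hC, hbd⟩ := exists_testFun_bound θ b M hb
  -- For integration from `0` the lower exponent must stay above `N`, to keep the majorant
  -- integrable at the origin.
  obtain ⟨σ₀, h0, h0N⟩ : ∃ σ₀ < p.1.re, (0 < r ∨ (0 ≤ r ∧ N < σ₀)) := by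
    rcases hr with h | ⟨h, h1⟩
    · exact ⟨p.1.re - 1, by linarith, Or.inl h⟩
    · obtain ⟨c, h2, h3⟩ := exists_between h1
      exact ⟨c, h3, Or.inr ⟨h, h2⟩⟩
  have hU : {p' : ℂ × ℂ × (Fin N → ℂ) | p'.2 ∈ maskDomain Z ∧
      maskParams Z θ p'.2 ∈ paramBox θ b M ∧ σ₀ < p'.1.re ∧ p'.1.re < p.1.re + 1} ∈ 𝓝 p := by
    have c2 : ContinuousAt (fun p : ℂ × ℂ × (Fin N → ℂ) => p.2) p := by fun_prop
    have c1 : ContinuousAt (fun p : ℂ × ℂ × (Fin N → ℂ) => p.1.re) p := by fun_prop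
    filter_upwards [c2.eventually ((isOpen_maskDomain Z).mem_nhds hq), c2.eventually hM,
      c1.eventually (lt_mem_nhds h0), c1.eventually (gt_mem_nhds (lt_add_one p.1.re))]
      with p' d1 d2 d3 d4 using ⟨d1, d2, d3, d4⟩
  refine differentiableAt_integral_of_bound hU (g := rayBound N C b σ₀ (p.1.re + 1)) ?_ ?_
    (integrableOn_rayBound hb ?_) ?_
  · rintro p' ⟨h1, -⟩
    exact (continuousOn_rayIntegrand (maskParams_mem_regDomain hZ h1) _ hr0).aestronglyMeasurable
      measurableSet_Ioi
  · filter_upwards [ae_restrict_mem measurableSet_Ioi] with x hx p' hp'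
    have hx : 0 < x := lt_of_le_of_lt hr0 hx
    refine DifferentiableAt.mul ?_ (by fun_prop)
    exact (differentiableAt_testFun_maskParams
      (nonPole_ofReal (maskParams_mem_regDomain hZ hp'.1) hx)).comp p' differentiableAt_snd
  · rcases h0N with h | ⟨h, h1⟩
    · exact Or.inl h
    · exact Or.inr ⟨h, h1, by linarith⟩
  · filter_upwards [ae_restrict_mem measurableSet_Ioi] with x hx p' hp'
    have hx : 0 < x := lt_of_le_of_lt hr0 hx
    rw [norm_mul, norm_exp_mul_log hx, rayBound]
    have := (hbd _ hp'.2.1).1 x hx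
    gcongr
    exact rpow_le_add hx hp'.2.2.1.le hp'.2.2.2.le

theorem norm_ofReal_mul_exp {r : ℝ} (hr : 0 < r) (t : ℝ) :
    ‖(r : ℂ) * Complex.exp (Complex.I * t)‖ = r := by
  rw [norm_mul, mul_comm Complex.I, Complex.norm_exp_ofReal_mul_I, mul_one,
    Complex.norm_of_nonneg hr.le]

theorem continuous_circleIntegrand {N : ℕ} {δ : Params N} {r : ℝ} (hr : Admissible r δ) (s : ℂ) :
    Continuous (fun t : ℝ =>
      integrand s δ r t * (r * Complex.I * Complex.exp (Complex.I * t))) := by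
  unfold integrand
  refine Continuous.mul (Continuous.mul ?_ (by fun_prop)) (by fun_prop)
  rw [continuous_iff_continuousAt]
  intro t
  refine ContinuousAt.comp (f := fun t : ℝ => (r : ℂ) * Complex.exp (Complex.I * t))
    (g := fun u => testFun u δ) (differentiableAt_testFun ?_).continuousAt (by fun_prop)
  exact hr.2 _ (by rw [norm_ofReal_mul_exp hr.1]; exact hr.1)
    (by rw [norm_ofReal_mul_exp hr.1])

theorem hankelConverges_of_mem_regDomain {N : ℕ} {δ : Params N} (hδ : δ ∈ regDomain N) {r : ℝ}
    (hr : Admissible r δ) (s : ℂ) : HankelConverges r s δ := by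
  refine ⟨?_, (continuous_circleIntegrand hr s).intervalIntegrable _ _, ?_⟩
  · simp only [integrand_zero]
    exact integrableOn_rayIntegrand hδ (Or.inl hr.1)
  · simp only [integrand_two_pi]
    exact (integrableOn_rayIntegrand hδ (Or.inl hr.1)).const_mul _

/-- A member of `radii` may vary discontinuously with the parameters, so holomorphy is proved with a
radius common to a whole neighbourhood. The uniform bounds on a box supply this radius. -/
theorem exists_radius_differentiableAt_hankelIntegral {N : ℕ} {Z : Finset (Fin N)} {θ : Fin N → ℝ}
    (hZ : ∀ ℓ ∈ Z, e (θ ℓ : ℂ) ≠ 1) {q : ℂ × (Fin N → ℂ)} (hq : q ∈ maskDomain Z) :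
    ∃ r, (∀ᶠ q' in 𝓝 q, Admissible r (maskParams Z θ q')) ∧ ∀ s, DifferentiableAt ℂ
      (fun p : ℂ × ℂ × (Fin N → ℂ) => hankelIntegral r p.1 (maskParams Z θ p.2)) (s, q) := by
  obtain ⟨b, hb, M, hM⟩ := eventually_mem_paramBox hZ hq
  obtain ⟨r, hr, C, hC, hbd⟩ := exists_testFun_bound θ b M hb
  refine ⟨r, ?_, fun s => ?_⟩
  · filter_upwards [hM] with q' hq'
    exact ⟨hr, fun u hu hur => ((hbd _ hq').2 u hu hur).1⟩
  simp only [hankelIntegral_eq]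
  refine DifferentiableAt.add (DifferentiableAt.mul ?_
    (differentiableAt_rayIntegral hZ hq (Or.inl hr))) ?_
  · unfold e
    fun_prop
  have hU : {p' : ℂ × ℂ × (Fin N → ℂ) | maskParams Z θ p'.2 ∈ paramBox θ b M ∧
      ‖p'.1 - 1‖ < ‖s - 1‖ + 1} ∈ 𝓝 (s, q) := by
    have c2 : ContinuousAt (fun p : ℂ × ℂ × (Fin N → ℂ) => p.2) (s, q) := by fun_prop
    have c1 : ContinuousAt (fun p : ℂ × ℂ × (Fin N → ℂ) => ‖p.1 - 1‖) (s, q) := by fun_prop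
    filter_upwards [c2.eventually hM, c1.eventually (gt_mem_nhds (lt_add_one ‖s - 1‖))]
      with p' d1 d2 using ⟨d1, d2⟩
  have hadm : ∀ δ ∈ paramBox θ b M, Admissible r δ :=
    fun δ hδ => ⟨hr, fun u hu hur => ((hbd _ hδ).2 u hu hur).1⟩
  simp only [circleIntegral, intervalIntegral.integral_of_le Real.two_pi_pos.le]
  refine differentiableAt_integral_of_bound hU (g := fun _ => C * r ^ (-N : ℝ) *
    Real.exp ((‖s - 1‖ + 1) * (|Real.log r| + 2 * Real.pi)) * r) ?_ ?_ (integrable_const _) ?_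
  · rintro p' ⟨h1, -⟩
    exact (continuous_circleIntegrand (hadm _ h1) _).aestronglyMeasurable
  · refine .of_forall fun t p' hp' => ?_
    unfold integrand
    refine DifferentiableAt.mul (DifferentiableAt.mul ?_ (by fun_prop)) (by fun_prop)
    exact DifferentiableAt.comp (g := fun q => testFun _ (maskParams Z θ q)) p'
      (differentiableAt_testFun_maskParams ((hadm _ hp'.1).2 _
        (by rw [norm_ofReal_mul_exp hr]; exact hr) (by rw [norm_ofReal_mul_exp hr])))
      differentiableAt_snd
  · filter_upwards [ae_restrict_mem measurableSet_Ioc] with t ht p' hp'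
    have h1 := ((hbd _ hp'.1).2 (r * Complex.exp (Complex.I * t))
      (by rw [norm_ofReal_mul_exp hr]; exact hr) (by rw [norm_ofReal_mul_exp hr])).2
    rw [norm_ofReal_mul_exp hr] at h1
    have h2 : ‖Complex.exp ((p'.1 - 1) * (Real.log r + Complex.I * t))‖ ≤
        Real.exp ((‖s - 1‖ + 1) * (|Real.log r| + 2 * Real.pi)) := by
      rw [Complex.norm_exp, Real.exp_le_exp]
      refine (Complex.re_le_norm _).trans ?_
      rw [norm_mul]
      have h3 : ‖(Real.log r : ℂ) + Complex.I * t‖ ≤ |Real.log r| + 2 * Real.pi := by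
        refine (norm_add_le _ _).trans ?_
        rw [norm_mul, Complex.norm_I, one_mul, Complex.norm_real, Complex.norm_real,
          Real.norm_eq_abs, Real.norm_eq_abs, abs_of_pos ht.1]
        linarith [ht.2]
      have := hp'.2.le
      gcongr
    rw [integrand, norm_mul, norm_mul]
    have h4 : ‖(r : ℂ) * Complex.I * Complex.exp (Complex.I * t)‖ = r := by
      rw [mul_right_comm, norm_mul, norm_ofReal_mul_exp hr, Complex.norm_I, mul_one]
    rw [h4]
    gcongr

/-! ### Deformation of the contour -/

theorem e_eq_exp_mul (s : ℂ) : e s = Complex.exp (s * ((2 * Real.pi : ℝ) * Complex.I)) := by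
  rw [e]
  congr 1
  push_cast
  ring

/-- In the coordinate `z = log u` the multivalued form `u^(s-1) du` becomes the entire form `exp(sz)
dz`, and the circle a vertical segment of length `2π`. -/
theorem circleIntegral_eq_log {N : ℕ} {r : ℝ} (hr : 0 < r) (s : ℂ) (δ : Params N) :
    circleIntegral r s δ = Complex.I * ∫ t in (0 : ℝ)..(2 * Real.pi),
      testFun (Complex.exp (Real.log r + t * Complex.I)) δ *
        Complex.exp (s * (Real.log r + t * Complex.I)) := by
  rw [circleIntegral, ← intervalIntegral.integral_const_mul]
  congr 1
  ext t
  have h1 : (r : ℂ) = Complex.exp (Real.log r) := by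
    rw [← Complex.ofReal_exp, Real.exp_log hr]
  have h2 : (r : ℂ) * Complex.exp (Complex.I * t) = Complex.exp (Real.log r + t * Complex.I) := by
    rw [Complex.exp_add, ← h1, mul_comm Complex.I]
  have h3 : Complex.exp ((s - 1) * (Real.log r + Complex.I * t)) *
      Complex.exp (Real.log r + t * Complex.I) =
      Complex.exp (s * (Real.log r + t * Complex.I)) := by
    rw [← Complex.exp_add]
    congr 1
    ring
  rw [integrand, mul_right_comm (r : ℂ), h2, ← h3]
  ring

theorem rayIntegral_sub {N : ℕ} {δ : Params N} (hδ : δ ∈ regDomain N) (s : ℂ) {r₁ r₂ : ℝ}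
    (h1 : 0 < r₁) (h12 : r₁ ≤ r₂) :
    rayIntegral r₁ s δ - rayIntegral r₂ s δ = ∫ x in (Real.log r₁)..(Real.log r₂),
      testFun (Complex.exp x) δ * Complex.exp (s * x) := by
  have h2 : 0 < r₂ := h1.trans_le h12
  rw [rayIntegral, rayIntegral,
    intervalIntegral.integral_Ioi_sub_Ioi (integrableOn_rayIntegrand hδ (Or.inl h1)) h12]
  have key := intervalIntegral.integral_deriv_smul_comp' (a := Real.log r₁) (b := Real.log r₂)
    (f := Real.exp) (f' := Real.exp)
    (g := fun x : ℝ => testFun (x : ℂ) δ * Complex.exp ((s - 1) * Real.log x))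
    (fun x _ => Real.hasDerivAt_exp x) Real.continuous_exp.continuousOn
    ((continuousOn_rayIntegrand hδ s le_rfl).mono (by
      rintro _ ⟨x, -, rfl⟩
      exact Real.exp_pos x))
  rw [Real.exp_log h1, Real.exp_log h2] at key
  rw [← key]
  congr 1
  ext x
  rw [Function.comp_apply, Real.log_exp, Complex.real_smul, Complex.ofReal_exp, sub_mul,
    Complex.exp_sub, one_mul]
  field_simp

/-- Cauchy's theorem on the rectangle `[log r₁, log r₂] × [0, 2π]`. The vertical sides are the two
circles; the top side is `e(s)` times the bottom one, which accounts for the difference of the rays.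
-/
theorem hankelIntegral_eq_of_le {N : ℕ} {δ : Params N} (hδ : δ ∈ regDomain N) (s : ℂ) {r₁ r₂ : ℝ}
    (h1 : 0 < r₁) (h12 : r₁ ≤ r₂) (h2 : Admissible r₂ δ) :
    hankelIntegral r₁ s δ = hankelIntegral r₂ s δ := by
  have hlog : Real.log r₁ ≤ Real.log r₂ := Real.log_le_log h1 h12
  have hdiff : DifferentiableOn ℂ (fun z => testFun (Complex.exp z) δ * Complex.exp (s * z))
      (uIcc ((Real.log r₁ : ℝ) : ℂ).re (Real.log r₂ + (2 * Real.pi : ℝ) * Complex.I : ℂ).re ×ℂ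
        uIcc ((Real.log r₁ : ℝ) : ℂ).im (Real.log r₂ + (2 * Real.pi : ℝ) * Complex.I : ℂ).im) := by
    intro z hz
    have hz1 : z.re ≤ Real.log r₂ := by
      have := hz.1
      simp only [Set.mem_preimage, Complex.ofReal_re, Complex.add_re, Complex.mul_re, Complex.I_re,
        mul_zero, Complex.ofReal_im, Complex.I_im, zero_mul, sub_zero, add_zero,
        uIcc_of_le hlog] at this
      exact this.2
    have hn : NonPole (Complex.exp z) δ := by
      refine h2.2 _ (norm_pos_iff.mpr (Complex.exp_ne_zero _)) ?_
      rw [Complex.norm_exp, ← Real.le_log_iff_exp_le h2.1]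
      exact hz1
    refine (DifferentiableAt.mul ?_ (by fun_prop)).differentiableWithinAt
    exact DifferentiableAt.comp (g := fun u => testFun u δ) z (differentiableAt_testFun hn)
      (by fun_prop)
  have h := Complex.integral_boundary_rect_eq_zero_of_differentiableOn _ _ _ hdiff
  simp only [Complex.ofReal_re, Complex.add_re, Complex.mul_re, Complex.I_re,
    mul_zero, Complex.ofReal_im, Complex.I_im, zero_mul, sub_zero, add_zero, mul_one, zero_add,
    Complex.add_im, Complex.mul_im, Complex.ofReal_zero, smul_eq_mul] at h
  have htop : ∀ x : ℝ, testFun (Complex.exp (x + (2 * Real.pi : ℝ) * Complex.I)) δ *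
      Complex.exp (s * (x + (2 * Real.pi : ℝ) * Complex.I)) =
      e s * (testFun (Complex.exp x) δ * Complex.exp (s * x)) := by
    intro x
    rw [mul_add, Complex.exp_add, Complex.exp_add, ← e_eq_exp_mul]
    have : Complex.exp (((2 * Real.pi : ℝ) : ℂ) * Complex.I) = 1 := by
      push_cast
      exact Complex.exp_two_pi_mul_I
    rw [this, mul_one]
    ring
  simp only [htop] at h
  rw [intervalIntegral.integral_const_mul, ← rayIntegral_sub hδ s h1 h12,
    ← circleIntegral_eq_log h1, ← circleIntegral_eq_log h2.1] at h
  rw [hankelIntegral_eq, hankelIntegral_eq]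
  linear_combination -h

theorem hankelIntegral_eq_of_admissible {N : ℕ} {δ : Params N} (hδ : δ ∈ regDomain N) (s : ℂ)
    {r₁ r₂ : ℝ} (h1 : Admissible r₁ δ) (h2 : Admissible r₂ δ) :
    hankelIntegral r₁ s δ = hankelIntegral r₂ s δ := by
  rcases le_total r₁ r₂ with h | h
  · exact hankelIntegral_eq_of_le hδ s h1.1 h h2
  · exact (hankelIntegral_eq_of_le hδ s h2.1 h h1).symm

/-- The test function is `O(r^(-N))` on the circle and `u^s` is `O(r^(Re s))`, so the integral is
`O(r^(Re s - N))`. -/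
theorem tendsto_circleIntegral_zero {N : ℕ} {δ : Params N} (hδ : δ ∈ regDomain N) {s : ℂ}
    (hs : N < s.re) : Tendsto (fun r => circleIntegral r s δ) (𝓝[>] 0) (𝓝 0) := by
  obtain ⟨b, hb, M, hM⟩ := exists_mem_paramBox hδ
  obtain ⟨r₀, hr₀, C, hC, hbd⟩ := exists_testFun_bound δ.2.2 b M hb
  have hlim : Tendsto (fun r : ℝ => C * Real.exp (‖s‖ * (2 * Real.pi)) * (2 * Real.pi) *
      r ^ (s.re - N)) (𝓝[>] 0) (𝓝 0) := by
    have h1 : Tendsto (fun r : ℝ => r ^ (s.re - N)) (𝓝 0) (𝓝 0) := by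
      have := (Real.continuousAt_rpow_const 0 (s.re - N) (Or.inr (by linarith))).tendsto
      rwa [Real.zero_rpow (by linarith)] at this
    simpa using (h1.mono_left nhdsWithin_le_nhds).const_mul
      (C * Real.exp (‖s‖ * (2 * Real.pi)) * (2 * Real.pi))
  refine squeeze_zero_norm' ?_ hlim
  filter_upwards [Ioo_mem_nhdsGT hr₀] with r hr
  rw [circleIntegral_eq_log hr.1, norm_mul, Complex.norm_I, one_mul]
  have hbound : ∀ t ∈ uIoc (0 : ℝ) (2 * Real.pi),
      ‖testFun (Complex.exp (Real.log r + t * Complex.I)) δ *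
        Complex.exp (s * (Real.log r + t * Complex.I))‖ ≤
      C * Real.exp (‖s‖ * (2 * Real.pi)) * r ^ (s.re - N) := by
    intro t ht
    rw [uIoc_of_le Real.two_pi_pos.le] at ht
    have h1 : ‖Complex.exp (Real.log r + t * Complex.I)‖ = r := by
      rw [Complex.norm_exp]
      simp [Real.exp_log hr.1]
    have h2 := ((hbd δ hM).2 (Complex.exp (Real.log r + t * Complex.I)) (by rw [h1]; exact hr.1)
      (by rw [h1]; exact hr.2.le)).2
    rw [h1] at h2
    have h3 : ‖Complex.exp (s * (Real.log r + t * Complex.I))‖ ≤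
        r ^ s.re * Real.exp (‖s‖ * (2 * Real.pi)) := by
      rw [Complex.norm_exp, Real.rpow_def_of_pos hr.1, ← Real.exp_add, Real.exp_le_exp]
      have h4 : -s.im ≤ ‖s‖ := (neg_le_abs _).trans (Complex.abs_im_le_norm s)
      have h5 : (s * (Real.log r + t * Complex.I)).re = Real.log r * s.re + -s.im * t := by
        simp
        ring
      rw [h5]
      have h6 : -s.im * t ≤ ‖s‖ * (2 * Real.pi) := by
        have := ht.1.le
        calc -s.im * t ≤ ‖s‖ * t := by gcongr
          _ ≤ _ := by
            gcongr
            exact ht.2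
      linarith
    rw [norm_mul]
    calc _ ≤ (C * r ^ (-N : ℝ)) * (r ^ s.re * Real.exp (‖s‖ * (2 * Real.pi))) := by
          have := hr.1
          gcongr
      _ = _ := by
        rw [sub_eq_add_neg, Real.rpow_add hr.1]
        ring
  refine (intervalIntegral.norm_integral_le_of_norm_le_const hbound).trans_eq ?_
  rw [sub_zero, abs_of_pos Real.two_pi_pos]
  ring

/-- For `Re s > N` the Hankel contour can be collapsed onto the half-line. -/
theorem hankelIntegral_eq_rayIntegral {N : ℕ} {δ : Params N} (hδ : δ ∈ regDomain N) {s : ℂ}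
    (hs : N < s.re) {r : ℝ} (hr : Admissible r δ) :
    hankelIntegral r s δ = (e s - 1) * rayIntegral 0 s δ := by
  have h1 : Tendsto (fun r => rayIntegral r s δ) (𝓝[>] 0) (𝓝 (rayIntegral 0 s δ)) := by
    have := (integrableOn_rayIntegrand hδ (s := s)
      (Or.inr ⟨le_rfl, hs⟩)).continuousWithinAt_Ici_primitive_Ioi
    exact this.tendsto.mono_left (nhdsWithin_mono _ Ioi_subset_Ici_self)
  have h2 : Tendsto (fun r => hankelIntegral r s δ) (𝓝[>] 0)
      (𝓝 ((e s - 1) * rayIntegral 0 s δ)) := by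
    simp only [hankelIntegral_eq]
    simpa using (h1.const_mul (e s - 1)).add (tendsto_circleIntegral_zero hδ hs)
  have h3 : Tendsto (fun r => hankelIntegral r s δ) (𝓝[>] 0) (𝓝 (hankelIntegral r s δ)) := by
    refine tendsto_const_nhds.congr' ?_
    filter_upwards [Ioo_mem_nhdsGT hr.1] with r' hr'
    exact (hankelIntegral_eq_of_le hδ s hr'.1 hr'.2.le hr).symm
  exact tendsto_nhds_unique h3 h2

/-! ### Continuation in `s` at regular parameters -/

/-- The entire continuation of `1 / (Γ(s) (e(s) - 1))` to the non-positive integers. -/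
noncomputable def gammaFactor (s : ℂ) : ℂ :=
  Complex.Gamma (1 - s) * Complex.exp (-(Real.pi * Complex.I * s)) / (2 * Real.pi * Complex.I)

/-- Euler's reflection formula combined with `e(s) - 1 = 2i exp(πis) sin(πs)`. -/
theorem one_div_gamma_mul_e_sub_one {s : ℂ} (hs : ¬∃ n : ℤ, s = n) :
    1 / (Complex.Gamma s * (e s - 1)) = gammaFactor s := by
  have hpi : (Real.pi : ℂ) ≠ 0 := Complex.ofReal_ne_zero.mpr Real.pi_ne_zero
  have he : e s - 1 ≠ 0 := sub_ne_zero.mpr fun h => hs ((e_eq_one_iff s).mp h)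
  have hE : Complex.exp (Real.pi * Complex.I * s) ≠ 0 := Complex.exp_ne_zero _
  have hexp : e s = Complex.exp (Real.pi * Complex.I * s) ^ 2 := by
    rw [e, ← Complex.exp_nat_mul]
    congr 1
    push_cast
    ring
  have hsin : e s - 1 = 2 * Complex.I * Complex.exp (Real.pi * Complex.I * s) *
      Complex.sin (Real.pi * s) := by
    rw [Complex.sin, show -(Real.pi * s) * Complex.I = -(Real.pi * Complex.I * s) by ring,
      show Real.pi * s * Complex.I = Real.pi * Complex.I * s by ring, Complex.exp_neg, hexp]
    field_simp
    linear_combination (Complex.exp (Real.pi * Complex.I * s) ^ 2 - 1) * Complex.I_sq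
  have hsin0 : Complex.sin (Real.pi * s) ≠ 0 := fun h => he (by rw [hsin, h, mul_zero])
  have hG := Complex.Gamma_mul_Gamma_one_sub s
  have hG0 : Complex.Gamma s ≠ 0 := by
    intro h
    rw [h, zero_mul, eq_comm, div_eq_zero_iff] at hG
    tauto
  rw [eq_div_iff hsin0] at hG
  rw [gammaFactor, Complex.exp_neg, hsin]
  field_simp
  linear_combination -hG

/-- `gammaFactor` is singular at the positive integers, but those beyond `N` lie in `Re s > N`,
where the half-line integral is used instead. -/
theorem one_sub_ne_neg_natCast {N : ℕ} {s : ℂ} (hs : s ∉ polePoints N) (hN : ¬(N : ℝ) < s.re)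
    (m : ℕ) : 1 - s ≠ -m := by
  intro h
  have h1 : s = ((m + 1 : ℕ) : ℂ) := by push_cast; linear_combination -h
  by_cases h2 : m + 1 ≤ N
  · exact hs ⟨m + 1, by omega, h2, h1⟩
  · refine hN ?_
    rw [h1, Complex.natCast_re]
    exact_mod_cast not_le.mp h2

theorem eventually_one_sub_ne {s : ℂ} (hs : ∀ m : ℕ, 1 - s ≠ -m) :
    ∀ᶠ z : ℂ in 𝓝 s, ∀ m : ℕ, 1 - z ≠ -m := by
  have h1 : Continuous fun z : ℂ => (Complex.Gamma (1 - z))⁻¹ :=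
    Complex.differentiable_one_div_Gamma.continuous.comp (by fun_prop)
  filter_upwards [h1.continuousAt.eventually_ne (inv_ne_zero (Complex.Gamma_ne_zero hs))] with z hz m hm
  -- `Complex.Gamma` takes the value `0` at its poles, so the inverse there is `0`, as for the
  -- entire function `1/Γ`.
  rw [hm, Complex.Gamma_neg_nat_eq_zero, inv_zero] at hz
  exact hz rfl

theorem differentiableAt_gammaFactor {s : ℂ} (hs : ∀ m : ℕ, 1 - s ≠ -m) :
    DifferentiableAt ℂ gammaFactor s := by
  unfold gammaFactor
  have h := DifferentiableAt.comp (g := Complex.Gamma) (f := fun s => 1 - s) s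
    (Complex.differentiableAt_Gamma _ hs) (by fun_prop)
  exact (DifferentiableAt.mul h (by fun_prop)).div_const _

/-- A fixed admissible radius function. -/
noncomputable def baseRadius (N : ℕ) : Params N → ℝ := (radii_nonempty N).some

theorem admissible_baseRadius {N : ℕ} {δ : Params N} (hδ : δ ∈ regDomain N) :
    Admissible (baseRadius N δ) δ :=
  admissible_of_mem_radii (radii_nonempty N).some_mem (regDomain_subset_goodDomain hδ)

open Classical in
/-- The continued zeta function at regular parameters. -/
noncomputable def regZeta {N : ℕ} (s : ℂ) (δ : Params N) : ℂ :=
  if (N : ℝ) < s.re then (Complex.Gamma s)⁻¹ * rayIntegral 0 s δ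
  else gammaFactor s * hankelIntegral (baseRadius N δ) s δ

theorem regZeta_of_lt {N : ℕ} {s : ℂ} (hs : (N : ℝ) < s.re) (δ : Params N) :
    regZeta s δ = (Complex.Gamma s)⁻¹ * rayIntegral 0 s δ := if_pos hs

/-- The two branches of `regZeta` agree away from the positive integers because the contour
collapses; any admissible radius may replace `baseRadius`. -/
theorem regZeta_eq_hankelIntegral {N : ℕ} {δ : Params N} (hδ : δ ∈ regDomain N) {r : ℝ}
    (hr : Admissible r δ) {s : ℂ} (hs : ∀ m : ℕ, 1 - s ≠ -m) :
    regZeta s δ = gammaFactor s * hankelIntegral r s δ := by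
  by_cases h : (N : ℝ) < s.re
  · have hint : ¬∃ n : ℤ, s = n := by
      rintro ⟨n, rfl⟩
      have h0 : (0 : ℝ) < (n : ℂ).re := lt_of_le_of_lt (Nat.cast_nonneg N) h
      rw [Complex.intCast_re] at h0
      have h1 : 0 < n := by exact_mod_cast h0
      refine hs (n - 1).toNat ?_
      have h2 : (((n - 1).toNat : ℤ) : ℂ) = ((n - 1 : ℤ) : ℂ) := by
        rw [Int.toNat_of_nonneg (by omega)]
      rw [Int.cast_natCast] at h2
      rw [h2]
      push_cast
      ring
    have he : e s - 1 ≠ 0 := sub_ne_zero.mpr fun h => hint ((e_eq_one_iff s).mp h)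
    rw [regZeta_of_lt h, hankelIntegral_eq_rayIntegral hδ h hr,
      ← one_div_gamma_mul_e_sub_one hint, one_div, mul_inv, mul_assoc, inv_mul_cancel_left₀ he]
  · rw [regZeta, if_neg h, hankelIntegral_eq_of_admissible hδ s hr (admissible_baseRadius hδ)]

theorem regZeta_eq_quotient {N : ℕ} {δ : Params N} (hδ : δ ∈ regDomain N) {r : ℝ}
    (hr : Admissible r δ) {s : ℂ} (hs : ¬∃ n : ℤ, s = n) :
    1 / (Complex.Gamma s * (e s - 1)) * hankelIntegral r s δ = regZeta s δ := by
  rw [regZeta_eq_hankelIntegral hδ hr, one_div_gamma_mul_e_sub_one hs]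
  intro m hm
  exact hs ⟨m + 1, by push_cast; linear_combination -hm⟩

theorem differentiableAt_regZeta {N : ℕ} {Z : Finset (Fin N)} {θ : Fin N → ℝ}
    (hZ : ∀ ℓ ∈ Z, e (θ ℓ : ℂ) ≠ 1) {s : ℂ} {q : ℂ × (Fin N → ℂ)} (hq : q ∈ maskDomain Z)
    (hs : s ∉ polePoints N) :
    DifferentiableAt ℂ (fun p : ℂ × ℂ × (Fin N → ℂ) => regZeta p.1 (maskParams Z θ p.2)) (s, q) := by
  by_cases h : (N : ℝ) < s.re
  · have hd : DifferentiableAt ℂ (fun p : ℂ × ℂ × (Fin N → ℂ) =>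
        (Complex.Gamma p.1)⁻¹ * rayIntegral 0 p.1 (maskParams Z θ p.2)) (s, q) := by
      refine DifferentiableAt.mul ?_ (differentiableAt_rayIntegral hZ hq (Or.inr ⟨le_rfl, h⟩))
      exact DifferentiableAt.comp (g := fun s => (Complex.Gamma s)⁻¹) (s, q)
        (Complex.differentiable_one_div_Gamma s) differentiableAt_fst
    refine hd.congr_of_eventuallyEq ?_
    have c1 : ContinuousAt (fun p : ℂ × ℂ × (Fin N → ℂ) => p.1.re) (s, q) := by fun_prop
    filter_upwards [c1.eventually (lt_mem_nhds h)] with p hp using regZeta_of_lt hp _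
  · obtain ⟨r, hr, hdr⟩ := exists_radius_differentiableAt_hankelIntegral hZ hq
    have hs' := one_sub_ne_neg_natCast hs h
    have hd : DifferentiableAt ℂ (fun p : ℂ × ℂ × (Fin N → ℂ) =>
        gammaFactor p.1 * hankelIntegral r p.1 (maskParams Z θ p.2)) (s, q) :=
      DifferentiableAt.mul (DifferentiableAt.comp (g := gammaFactor) (s, q)
        (differentiableAt_gammaFactor hs') differentiableAt_fst) (hdr s)
    refine hd.congr_of_eventuallyEq ?_
    have c1 : ContinuousAt (fun p : ℂ × ℂ × (Fin N → ℂ) => p.1) (s, q) := by fun_prop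
    have c2 : ContinuousAt (fun p : ℂ × ℂ × (Fin N → ℂ) => p.2) (s, q) := by fun_prop
    filter_upwards [c1.eventually (eventually_one_sub_ne hs'), c2.eventually hr,
      c2.eventually ((isOpen_maskDomain Z).mem_nhds hq)] with p h1 h2 h3
    exact regZeta_eq_hankelIntegral (maskParams_mem_regDomain hZ h3) h2 h1

theorem exists_mask {N : ℕ} {δ : Params N} (hδ : δ ∈ regDomain N) :
    ∃ Z : Finset (Fin N), (∀ ℓ ∈ Z, e (δ.2.2 ℓ : ℂ) ≠ 1) ∧
      (∀ β : ℂ, maskParams Z δ.2.2 (β * δ.1, fun ℓ => β * δ.2.1 ℓ) = MMap β δ) ∧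
      ∀ β : ℂ, ((β * δ.1, fun ℓ => β * δ.2.1 ℓ) ∈ maskDomain Z ↔ MMap β δ ∈ regDomain N) := by
  classical
  refine ⟨Finset.univ.filter fun ℓ => δ.2.1 ℓ = 0, fun ℓ hℓ => ?_, fun β => ?_, fun β => ?_⟩
  · have h0 : δ.2.1 ℓ = 0 := by simpa using hℓ
    rcases hδ.2 ℓ with h | h
    · exact h.2
    · simp [h0] at h
  · simp only [maskParams, MMap, Prod.mk.injEq, and_true, true_and]
    ext ℓ
    by_cases h : δ.2.1 ℓ = 0 <;> simp [h]
  · simp only [maskDomain, regDomain, MMap, mem_ofPred_eq, Finset.mem_filter, Finset.mem_univ,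
      true_and]
    refine and_congr_right fun _ => forall_congr' fun ℓ => ?_
    rcases hδ.2 ℓ with h | h
    · simp [h.1, h.2]
    · have h0 : δ.2.1 ℓ ≠ 0 := by rintro h0; simp [h0] at h
      simp only [h0, not_false_eq_true, true_imp_iff]
      refine ⟨Or.inr, ?_⟩
      rintro (⟨h1, h2⟩ | h1)
      -- The value `β = 0` contradicts `0 < Re (β w)`.
      · have hβ : β = 0 := by simpa [h0] using h1
        subst hβ
        simp_all
      · exact h1

theorem MMap_one {N : ℕ} (δ : Params N) : MMap 1 δ = δ := by
  simp [MMap]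

theorem differentiableAt_regZeta_left {N : ℕ} {δ : Params N} (hδ : δ ∈ regDomain N) {s : ℂ}
    (hs : s ∉ polePoints N) : DifferentiableAt ℂ (fun s => regZeta s δ) s := by
  obtain ⟨Z, hZ, h1, h2⟩ := exists_mask hδ
  have hq := (h2 1).mpr (by rwa [MMap_one])
  have h3 := DifferentiableAt.comp (f := fun s : ℂ => (s, ((1 : ℂ) * δ.1, fun ℓ => 1 * δ.2.1 ℓ))) s
    (differentiableAt_regZeta hZ hq hs) (by fun_prop)
  refine h3.congr_of_eventuallyEq (.of_forall fun s => ?_)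
  rw [Function.comp_apply]
  dsimp only
  rw [h1, MMap_one]

theorem eventually_not_int (s : ℂ) : ∀ᶠ z : ℂ in 𝓝[≠] s, ¬∃ n : ℤ, z = n := by
  have h1 : HasDerivAt e (Complex.exp (2 * Real.pi * Complex.I * s) * (2 * Real.pi * Complex.I)) s := by
    have := ((hasDerivAt_id s).const_mul (2 * Real.pi * Complex.I)).cexp
    simpa using! this
  filter_upwards [h1.eventually_ne (c := 1) (mul_ne_zero (Complex.exp_ne_zero _)
    Complex.two_pi_I_ne_zero)] with z hz h
  exact hz ((e_eq_one_iff z).mpr h)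

/-! ### Reflection -/

/-- The constant relating the test functions at `δ` and at its reflection. -/
noncomputable def reflConst {N : ℕ} (Λ : Finset (Fin N)) (θ : Fin N → ℝ) : ℂ :=
  ∏ ℓ ∈ Λ, -(e (θ ℓ))⁻¹

theorem e_neg (z : ℂ) : e (-z) = (e z)⁻¹ := by
  rw [e, e, ← Complex.exp_neg]
  congr 1
  ring

theorem testFun_eq_reflConst_mul {N : ℕ} (Λ : Finset (Fin N)) (δ : Params N) (u : ℂ) :
    testFun u δ = reflConst Λ δ.2.2 * testFun u (TMap Λ δ) := by
  have h1 : ∀ E X : ℂ, E ≠ 0 → X ≠ 0 →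
      (1 - E * X)⁻¹ = -E⁻¹ * (X⁻¹ * (1 - E⁻¹ * X⁻¹)⁻¹) := by
    intro E X hE hX
    -- At a pole both sides vanish because `0⁻¹ = 0`, so the identity holds without exception.
    by_cases h : E * X = 1
    · rw [show E⁻¹ * X⁻¹ = 1 by rw [← mul_inv, h, inv_one], h]
      simp
    · have h2 : 1 - E * X ≠ 0 := sub_ne_zero.mpr (Ne.symm h)
      have h3 : 1 - E⁻¹ * X⁻¹ = -(1 - E * X) * (E⁻¹ * X⁻¹) := by field_simp; ring
      rw [h3, mul_inv, mul_inv, inv_inv, inv_inv]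
      field_simp
  have h2 : ∀ ℓ, (1 - e (δ.2.2 ℓ) * Complex.exp (-(u * δ.2.1 ℓ)))⁻¹ =
      (if ℓ ∈ Λ then -(e (δ.2.2 ℓ))⁻¹ else 1) * (if ℓ ∈ Λ then Complex.exp (u * δ.2.1 ℓ) else 1) *
        (1 - e ((TMap Λ δ).2.2 ℓ) * Complex.exp (-(u * (TMap Λ δ).2.1 ℓ)))⁻¹ := by
    intro ℓ
    by_cases h : ℓ ∈ Λ
    · simp only [TMap, if_pos h]
      rw [h1 _ _ (e_ne_zero _) (Complex.exp_ne_zero _), Complex.ofReal_neg, e_neg, mul_neg u,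
        neg_neg, Complex.exp_neg, inv_inv]
      ring
    · simp [TMap, h]
  rw [testFun, Finset.prod_congr rfl fun ℓ _ => h2 ℓ, Finset.prod_mul_distrib,
    Finset.prod_mul_distrib, Finset.prod_ite_mem, Finset.prod_ite_mem, Finset.univ_inter, testFun,
    reflConst, ← Complex.exp_sum, ← Finset.mul_sum]
  have h3 : Complex.exp (-(u * (TMap Λ δ).1)) =
      Complex.exp (-(u * δ.1)) * Complex.exp (u * ∑ ℓ ∈ Λ, δ.2.1 ℓ) := by
    rw [← Complex.exp_add]
    congr 1
    simp only [TMap, trace]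
    ring
  rw [h3]
  ring

theorem hankelIntegral_eq_reflConst_mul {N : ℕ} (Λ : Finset (Fin N)) (δ : Params N) (r : ℝ) (s : ℂ) :
    hankelIntegral r s δ = reflConst Λ δ.2.2 * hankelIntegral r s (TMap Λ δ) := by
  have h : ∀ r t, integrand s δ r t = reflConst Λ δ.2.2 * integrand s (TMap Λ δ) r t := by
    intro r t
    rw [integrand, integrand, testFun_eq_reflConst_mul Λ, mul_assoc]
  simp only [hankelIntegral, h, mul_assoc, integral_const_mul, intervalIntegral.integral_const_mul]
  ring

theorem hankelConverges_of_TMap {N : ℕ} (Λ : Finset (Fin N)) (δ : Params N) (r : ℝ) (s : ℂ)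
    (h : HankelConverges r s (TMap Λ δ)) : HankelConverges r s δ := by
  have h1 : ∀ r t, integrand s δ r t = reflConst Λ δ.2.2 * integrand s (TMap Λ δ) r t := by
    intro r t
    rw [integrand, integrand, testFun_eq_reflConst_mul Λ, mul_assoc]
  simp only [HankelConverges, h1, mul_assoc] at h ⊢
  exact ⟨h.1.const_mul _, h.2.1.const_mul _, h.2.2.const_mul _⟩

theorem nonPole_TMap_iff {N : ℕ} (Λ : Finset (Fin N)) (δ : Params N) (u : ℂ) :
    NonPole u (TMap Λ δ) ↔ NonPole u δ := by
  rw [nonPole_iff, nonPole_iff]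
  refine forall_congr' fun ℓ => ?_
  by_cases h : ℓ ∈ Λ
  · simp only [TMap, if_pos h]
    rw [Complex.ofReal_neg, e_neg, mul_neg, Complex.exp_neg]
    exact inv_injective.ne_iff
  · simp [TMap, h]

theorem admissible_TMap_iff {N : ℕ} (Λ : Finset (Fin N)) (δ : Params N) (r : ℝ) :
    Admissible r (TMap Λ δ) ↔ Admissible r δ := by
  simp only [Admissible, nonPole_TMap_iff]

theorem mem_goodDomain_TMap_iff {N : ℕ} (Λ : Finset (Fin N)) (δ : Params N) :
    TMap Λ δ ∈ goodDomain N ↔ δ ∈ goodDomain N := by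
  refine forall_congr' fun ℓ => ?_
  by_cases h : ℓ ∈ Λ
  · simp only [TMap, if_pos h, neg_eq_zero]
    refine imp_congr_right fun _ => ⟨fun h1 n hn => h1 (-n) ?_, fun h1 n hn => h1 (-n) ?_⟩
    · rw [hn]; push_cast; rfl
    · rw [Int.cast_neg, ← hn, neg_neg]
  · simp [TMap, h]

theorem hankelQuotient_eq_regZeta {N : ℕ} {ε : Params N → ℝ} (hε : ε ∈ radii N)
    {Λ : Finset (Fin N)} {δ : Params N} (hδ : TMap Λ δ ∈ regDomain N) {s : ℂ}
    (hs : ¬∃ n : ℤ, s = n) :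
    hankelQuotient ε s δ = reflConst Λ δ.2.2 * regZeta s (TMap Λ δ) := by
  have hg : δ ∈ goodDomain N := (mem_goodDomain_TMap_iff Λ δ).mp (regDomain_subset_goodDomain hδ)
  rw [hankelQuotient, hankelIntegral_eq_reflConst_mul Λ, ← regZeta_eq_quotient hδ
    ((admissible_TMap_iff Λ δ _).mpr (admissible_of_mem_radii hε hg)) hs]
  ring

/-- The quotient agrees off the integers with a multiple of `regZeta`, which is continuous at `s`;
hence its singularities outside `polePoints N` are removable. -/
theorem tendsto_hankelQuotient {N : ℕ} {ε : Params N → ℝ} (hε : ε ∈ radii N)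
    {Λ : Finset (Fin N)} {δ : Params N} (hδ : TMap Λ δ ∈ regDomain N) {s : ℂ}
    (hs : s ∉ polePoints N) :
    Tendsto (fun z => hankelQuotient ε z δ) (𝓝[≠] s)
      (𝓝 (reflConst Λ δ.2.2 * regZeta s (TMap Λ δ))) := by
  have h1 : Tendsto (fun z => reflConst Λ δ.2.2 * regZeta z (TMap Λ δ)) (𝓝[≠] s)
      (𝓝 (reflConst Λ δ.2.2 * regZeta s (TMap Λ δ))) :=
    ((differentiableAt_regZeta_left hδ hs).continuousAt.tendsto.const_mul _).mono_left
      nhdsWithin_le_nhds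
  refine h1.congr' ?_
  filter_upwards [eventually_not_int s] with z hz
  exact (hankelQuotient_eq_regZeta hε hδ hz).symm

theorem LEps_eq_regZeta {N : ℕ} {ε : Params N → ℝ} (hε : ε ∈ radii N)
    {Λ : Finset (Fin N)} {δ : Params N} (hδ : TMap Λ δ ∈ regDomain N) {s : ℂ}
    (hs : s ∉ polePoints N) :
    LEps ε s δ = reflConst Λ δ.2.2 * regZeta s (TMap Λ δ) := by
  rw [LEps]
  split_ifs with h
  · exact (tendsto_hankelQuotient hε hδ hs).limUnder_eq
  · exact hankelQuotient_eq_regZeta hε hδ h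

/-! ### Homogeneity under scaling and rotation -/

theorem testFun_MMap {N : ℕ} (u α : ℂ) (δ : Params N) :
    testFun u (MMap α δ) = testFun (α * u) δ := by
  simp only [testFun, MMap, ← mul_assoc, mul_comm u α]

theorem nonPole_MMap {N : ℕ} (u α : ℂ) (δ : Params N) :
    NonPole u (MMap α δ) ↔ NonPole (α * u) δ := by
  simp only [NonPole, MMap, ← mul_assoc, mul_comm u α]

/-- The constant `c` stands for `i Arg u`, so one identity serves both the ray and the circle; the
isolated factor `α` is the Jacobian. -/
theorem exp_mul_log_scale {α x : ℝ} (hα : 0 < α) (hx : 0 < x) (s c : ℂ) :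
    Complex.exp ((s - 1) * (Real.log x + c)) = Complex.exp (-(s * Real.log α)) *
      (α * Complex.exp ((s - 1) * (Real.log (α * x) + c))) := by
  have h1 : (α : ℂ) = Complex.exp (Real.log α) := by
    rw [← Complex.ofReal_exp, Real.exp_log hα]
  have h2 : ∀ z, (α : ℂ) * Complex.exp z = Complex.exp (Real.log α + z) := fun z => by
    rw [Complex.exp_add, ← h1]
  rw [h2, ← Complex.exp_add, Real.log_mul hα.ne' hx.ne']
  congr 1
  push_cast
  ring

theorem rayIntegral_MMap {N : ℕ} {α : ℝ} (hα : 0 < α) {r : ℝ} (hr : 0 ≤ r) (s : ℂ) (δ : Params N) :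
    rayIntegral r s (MMap α δ) = Complex.exp (-(s * Real.log α)) * rayIntegral (α * r) s δ := by
  have h1 : rayIntegral r s (MMap α δ) = ∫ x in Ioi r, (Complex.exp (-(s * Real.log α)) * α) *
      (fun x : ℝ => testFun (x : ℂ) δ * Complex.exp ((s - 1) * Real.log x)) (α * x) := by
    refine setIntegral_congr_fun measurableSet_Ioi fun x hx => ?_
    have h2 := exp_mul_log_scale hα (lt_of_le_of_lt hr hx) s 0
    rw [add_zero, add_zero] at h2
    dsimp only
    rw [h2, testFun_MMap, Complex.ofReal_mul]
    ring
  rw [h1, integral_const_mul, integral_comp_mul_left_Ioi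
    (fun x : ℝ => testFun (x : ℂ) δ * Complex.exp ((s - 1) * Real.log x)) r hα, Complex.real_smul, rayIntegral,
    Complex.ofReal_inv]
  have : (α : ℂ) ≠ 0 := Complex.ofReal_ne_zero.mpr hα.ne'
  field_simp

theorem circleIntegral_MMap {N : ℕ} {α : ℝ} (hα : 0 < α) {r : ℝ} (hr : 0 < r) (s : ℂ)
    (δ : Params N) :
    circleIntegral r s (MMap α δ) = Complex.exp (-(s * Real.log α)) * circleIntegral (α * r) s δ := by
  rw [circleIntegral, circleIntegral, ← intervalIntegral.integral_const_mul]
  congr 1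
  ext t
  rw [integrand, integrand, testFun_MMap, exp_mul_log_scale hα hr, Complex.ofReal_mul,
    ← mul_assoc (α : ℂ) (r : ℂ)]
  ring

theorem regZeta_MMap_ofReal {N : ℕ} {δ : Params N} (hδ : δ ∈ regDomain N) {α : ℝ} (hα : 0 < α)
    (s : ℂ) : regZeta s (MMap α δ) = Complex.exp (-(s * Real.log α)) * regZeta s δ := by
  have hδ' : MMap α δ ∈ regDomain N := by
    refine ⟨by simpa [MMap, hα] using hδ.1, fun ℓ => ?_⟩
    rcases hδ.2 ℓ with ⟨h, h'⟩ | h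
    · exact Or.inl ⟨by simp [MMap, h], h'⟩
    · exact Or.inr (by simpa [MMap, hα] using h)
  by_cases h : (N : ℝ) < s.re
  · rw [regZeta_of_lt h, regZeta_of_lt h, rayIntegral_MMap hα le_rfl, mul_zero]
    ring
  · have h1 := admissible_baseRadius hδ'
    have h2 : Admissible (α * baseRadius N (MMap α δ)) δ := by
      refine ⟨mul_pos hα h1.1, fun u hu hur => ?_⟩
      have h3 := h1.2 ((α : ℂ)⁻¹ * u) ?_ ?_
      · rw [nonPole_MMap, mul_inv_cancel_left₀ (Complex.ofReal_ne_zero.mpr hα.ne')] at h3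
        exact h3
      · rw [norm_mul, norm_inv, Complex.norm_of_nonneg hα.le]
        positivity
      · rw [norm_mul, norm_inv, Complex.norm_of_nonneg hα.le, inv_mul_le_iff₀ hα]
        exact hur
    rw [regZeta, if_neg h, regZeta, if_neg h,
      hankelIntegral_eq_of_admissible hδ s (admissible_baseRadius hδ) h2, hankelIntegral_eq,
      hankelIntegral_eq, rayIntegral_MMap hα h1.1.le, circleIntegral_MMap hα h1.1]
    ring

theorem isOpen_setOf_MMap_mem_regDomain {N : ℕ} {δ : Params N} (hδ : δ ∈ regDomain N) :
    IsOpen {β : ℂ | MMap β δ ∈ regDomain N} := by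
  obtain ⟨Z, -, -, h⟩ := exists_mask hδ
  have h1 : {β : ℂ | MMap β δ ∈ regDomain N} =
      (fun β : ℂ => (β * δ.1, fun ℓ => β * δ.2.1 ℓ)) ⁻¹' maskDomain Z := by
    ext β
    exact (h β).symm
  rw [h1]
  exact (isOpen_maskDomain Z).preimage (by fun_prop)

/-- The set is cut out by half-plane conditions on `β`. Convexity provides the connectedness needed
by the identity theorem. -/
theorem convex_setOf_MMap_mem_regDomain {N : ℕ} {δ : Params N} (hδ : δ ∈ regDomain N) :
    Convex ℝ {β : ℂ | MMap β δ ∈ regDomain N} := by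
  obtain ⟨Z, -, -, h⟩ := exists_mask hδ
  intro β hβ γ hγ x y hx hy hxy
  rw [mem_ofPred_eq, ← h] at hβ hγ ⊢
  have key : ∀ z : ℂ, 0 < (β * z).re → 0 < (γ * z).re → 0 < ((x • β + y • γ) * z).re := by
    intro z h1 h2
    have h3 : ((x • β + y • γ) * z).re = x * (β * z).re + y * (γ * z).re := by
      simp
      ring
    rw [h3]
    rcases hx.eq_or_lt with rfl | hx
    · have : y = 1 := by linarith
      simpa [this] using h2
    · positivity
  exact ⟨key _ hβ.1 hγ.1, fun ℓ hℓ => key _ (hβ.2 ℓ hℓ) (hγ.2 ℓ hℓ)⟩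

/-- A real `β ≤ 0` would destroy the positivity of `Re w`; hence the principal logarithm is
holomorphic on all admissible scalings. -/
theorem mem_slitPlane_of_MMap_mem {N : ℕ} {δ : Params N} (hδ : δ ∈ regDomain N) {β : ℂ}
    (hβ : MMap β δ ∈ regDomain N) : β ∈ Complex.slitPlane := by
  by_contra h
  rw [Complex.mem_slitPlane_iff, not_or, not_lt, not_not] at h
  have h1 := hβ.1
  simp only [MMap, Complex.mul_re, h.2, zero_mul, sub_zero] at h1
  have := hδ.1
  nlinarith [h.1]

/-- Homogeneity of the zeta function in `(w, a)`, for complex scalings. -/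
theorem regZeta_MMap {N : ℕ} {δ : Params N} (hδ : δ ∈ regDomain N) {β : ℂ}
    (hβ : MMap β δ ∈ regDomain N) {s : ℂ} (hs : s ∉ polePoints N) :
    regZeta s (MMap β δ) = Complex.exp (-(s * Complex.log β)) * regZeta s δ := by
  have hopen := isOpen_setOf_MMap_mem_regDomain hδ
  have hf : AnalyticOnNhd ℂ (fun β => regZeta s (MMap β δ)) {β : ℂ | MMap β δ ∈ regDomain N} := by
    refine DifferentiableOn.analyticOnNhd (fun γ hγ => ?_) hopen
    obtain ⟨Z, hZ, h1, h2⟩ := exists_mask hδ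
    have h3 := DifferentiableAt.comp
      (f := fun γ : ℂ => (s, (γ * δ.1, fun ℓ => γ * δ.2.1 ℓ))) γ
      (differentiableAt_regZeta hZ ((h2 γ).mpr hγ) hs) (by fun_prop)
    refine (h3.congr_of_eventuallyEq (.of_forall fun γ => ?_)).differentiableWithinAt
    rw [Function.comp_apply]
    dsimp only
    rw [h1]
  have hg : AnalyticOnNhd ℂ (fun β => Complex.exp (-(s * Complex.log β)) * regZeta s δ)
      {β : ℂ | MMap β δ ∈ regDomain N} := by
    refine DifferentiableOn.analyticOnNhd (fun γ hγ => ?_) hopen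
    have := Complex.differentiableAt_log (mem_slitPlane_of_MMap_mem hδ hγ)
    refine DifferentiableAt.differentiableWithinAt ?_
    fun_prop
  have h1 : (1 : ℂ) ∈ {β : ℂ | MMap β δ ∈ regDomain N} := by rwa [mem_ofPred_eq, MMap_one]
  -- Both sides agree at real `t > 1`, and these points accumulate at `1`.
  refine hf.eqOn_of_preconnected_of_frequently_eq hg
    (convex_setOf_MMap_mem_regDomain hδ).isPreconnected h1 ?_ hβ
  have hlim : Tendsto (fun t : ℝ => (t : ℂ)) (𝓝[>] 1) (𝓝[≠] 1) := by
    refine tendsto_nhdsWithin_iff.mpr ⟨?_, ?_⟩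
    · exact (Complex.continuous_ofReal.tendsto' 1 1 (by simp)).mono_left nhdsWithin_le_nhds
    · filter_upwards [self_mem_nhdsWithin] with t ht
      simpa using ne_of_gt (show (1 : ℝ) < t from ht)
  refine hlim.frequently (Eventually.frequently ?_)
  filter_upwards [self_mem_nhdsWithin] with t ht
  have ht : (0 : ℝ) < t := zero_lt_one.trans ht
  rw [regZeta_MMap_ofReal hδ ht, Complex.ofReal_log ht.le]

/-- `exp(iω)`. -/
noncomputable def rot (ω : ℝ) : ℂ := Complex.exp (Complex.I * ω)

theorem MMap_MMap {N : ℕ} (α β : ℂ) (δ : Params N) : MMap α (MMap β δ) = MMap (α * β) δ := by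
  simp [MMap, mul_assoc]

/-- The product `exp(iωs) regZeta` is the same at both angles, by homogeneity with factor `exp(i(ω'
- ω))`. The bounds on `ω' - ω` make `i(ω' - ω)` its principal logarithm. -/
theorem regZeta_rot {N : ℕ} {δ : Params N} {ω ω' : ℝ} (hδ : MMap (rot ω) δ ∈ regDomain N)
    (hδ' : MMap (rot ω') δ ∈ regDomain N) (h1 : -Real.pi < ω' - ω) (h2 : ω' - ω ≤ Real.pi) {s : ℂ}
    (hs : s ∉ polePoints N) :
    Complex.exp (Complex.I * ω' * s) * regZeta s (MMap (rot ω') δ) =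
      Complex.exp (Complex.I * ω * s) * regZeta s (MMap (rot ω) δ) := by
  have h3 : rot ω' = rot (ω' - ω) * rot ω := by
    rw [rot, rot, rot, ← Complex.exp_add]
    congr 1
    push_cast
    ring
  have h4 : Complex.log (rot (ω' - ω)) = Complex.I * (ω' - ω : ℝ) := by
    rw [rot]
    apply Complex.log_exp <;> simp <;> linarith
  rw [h3, ← MMap_MMap] at hδ' ⊢
  rw [regZeta_MMap hδ hδ' hs, h4, ← mul_assoc, ← Complex.exp_add]
  congr 2
  push_cast
  ring

/-! ### Poles at `1, …, N` -/

theorem differentiable_hankelIntegral {N : ℕ} {δ : Params N} (hδ : δ ∈ regDomain N) :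
    ∃ r, Admissible r δ ∧ Differentiable ℂ fun s => hankelIntegral r s δ := by
  obtain ⟨Z, hZ, h1, h2⟩ := exists_mask hδ
  have hq := (h2 1).mpr (by rwa [MMap_one])
  obtain ⟨r, hr, hd⟩ := exists_radius_differentiableAt_hankelIntegral hZ hq
  have h3 := hr.self_of_nhds
  rw [h1, MMap_one] at h3
  refine ⟨r, h3, fun s => ?_⟩
  have h4 := DifferentiableAt.comp
    (f := fun s : ℂ => (s, ((1 : ℂ) * δ.1, fun ℓ => 1 * δ.2.1 ℓ))) s (hd s) (by fun_prop)
  refine h4.congr_of_eventuallyEq (.of_forall fun s => ?_)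
  rw [Function.comp_apply]
  dsimp only
  rw [h1, MMap_one]

/-- Near `k` the function is an entire function divided by `e(s) - 1`, which has a simple zero
there. -/
theorem meromorphicAt_mul_regZeta {N : ℕ} {δ : Params N} (hδ : δ ∈ regDomain N) {g : ℂ → ℂ}
    (hg : Differentiable ℂ g) {k : ℂ} (hk : k ∈ polePoints N) :
    MeromorphicAt (fun s => g s * regZeta s δ) k ∧
      ((-1 : ℤ) : WithTop ℤ) ≤ meromorphicOrderAt (fun s => g s * regZeta s δ) k := by
  obtain ⟨r, hr, hd⟩ := differentiable_hankelIntegral hδ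
  have he : HasDerivAt (fun s => e s - 1)
      (Complex.exp (2 * Real.pi * Complex.I * k) * (2 * Real.pi * Complex.I)) k := by
    have := (((hasDerivAt_id k).const_mul (2 * Real.pi * Complex.I)).cexp).sub_const 1
    simpa using! this
  have he' : Differentiable ℂ fun s => e s - 1 := by
    unfold e
    fun_prop
  have hA : AnalyticAt ℂ (fun s => (Complex.Gamma s)⁻¹ * (g s * hankelIntegral r s δ)) k :=
    (Complex.differentiable_one_div_Gamma.mul (hg.mul hd)).analyticAt k
  have hE : AnalyticAt ℂ (fun s => e s - 1) k := he'.analyticAt k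
  have hek : e k = 1 := by
    obtain ⟨n, -, -, rfl⟩ := hk
    exact (e_eq_one_iff _).mpr ⟨n, by simp⟩
  have hord : meromorphicOrderAt (fun s => e s - 1) k = 1 := by
    rw [hE.meromorphicOrderAt_eq]
    have := hE.analyticOrderAt_sub_eq_one_of_deriv_ne_zero
      (by rw [he.deriv]; exact mul_ne_zero (Complex.exp_ne_zero _) Complex.two_pi_I_ne_zero)
    simp only [hek, sub_self, sub_zero] at this
    rw [this]
    rfl
  have hcongr : (fun s => g s * regZeta s δ) =ᶠ[𝓝[≠] k]
      (fun s => (Complex.Gamma s)⁻¹ * (g s * hankelIntegral r s δ)) * (fun s => e s - 1)⁻¹ := by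
    filter_upwards [eventually_not_int k] with s hs
    rw [← regZeta_eq_quotient hδ hr hs, Pi.mul_apply, Pi.inv_apply, one_div, mul_inv]
    ring
  refine ⟨(hA.meromorphicAt.mul hE.meromorphicAt.inv).congr hcongr.symm, ?_⟩
  rw [meromorphicOrderAt_congr hcongr, meromorphicOrderAt_mul hA.meromorphicAt
    hE.meromorphicAt.inv, meromorphicOrderAt_inv, hord]
  have h0 := hA.meromorphicOrderAt_nonneg
  calc ((-1 : ℤ) : WithTop ℤ) = 0 + -1 := by rfl
    _ ≤ _ := by gcongr

/-! ### The Barnes series as a half-line integral -/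

/-- This is homogeneity in the case `N = 0`, where the test function is `exp(-uw)`: Euler's integral
at `w = 1`, scaled by `b`. -/
theorem integral_exp_neg_mul_cpow {b s : ℂ} (hb : 0 < b.re) (hs : 0 < s.re) :
    IntegrableOn (fun x : ℝ => Complex.exp (-(x * b)) * Complex.exp ((s - 1) * Real.log x)) (Ioi 0) ∧
    ∫ x in Ioi (0 : ℝ), Complex.exp (-(x * b)) * Complex.exp ((s - 1) * Real.log x) =
      Complex.Gamma s * Complex.exp (-(s * Complex.log b)) := by
  have hreg : ∀ c : ℂ, 0 < c.re → ((c, 0, 0) : Params 0) ∈ regDomain 0 := fun c hc =>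
    ⟨hc, fun ℓ => ℓ.elim0⟩
  have hs0 : ((0 : ℕ) : ℝ) < s.re := by simpa using hs
  have hfun : ∀ (c : ℂ) (x : ℝ), testFun (x : ℂ) ((c, 0, 0) : Params 0) = Complex.exp (-(x * c)) := by
    simp [testFun]
  have hray : ∀ c : ℂ, rayIntegral 0 s ((c, 0, 0) : Params 0) =
      ∫ x in Ioi (0 : ℝ), Complex.exp (-(x * c)) * Complex.exp ((s - 1) * Real.log x) := by
    intro c
    simp only [rayIntegral, hfun]
  refine ⟨?_, ?_⟩
  · have := integrableOn_rayIntegrand (hreg b hb) (s := s) (r := 0) (Or.inr ⟨le_rfl, hs0⟩)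
    simpa only [hfun] using this
  have h1 : ∫ x in Ioi (0 : ℝ), Complex.exp (-(x * (1 : ℂ))) * Complex.exp ((s - 1) * Real.log x) =
      Complex.Gamma s := by
    rw [Complex.Gamma_eq_integral hs, Complex.GammaIntegral]
    refine setIntegral_congr_fun measurableSet_Ioi fun x hx => ?_
    have hx : (x : ℂ) ≠ 0 := Complex.ofReal_ne_zero.mpr (ne_of_gt hx)
    rw [Complex.cpow_def_of_ne_zero hx, mul_one, Complex.ofReal_exp, Complex.ofReal_neg,
      ← Complex.ofReal_log (le_of_lt ‹x ∈ Ioi 0›), mul_comm (s - 1)]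
  have hM : MMap b ((1, 0, 0) : Params 0) = (b, 0, 0) := by
    simp only [MMap, mul_one, Pi.zero_apply, mul_zero]
    rfl
  have hG : Complex.Gamma s ≠ 0 := Complex.Gamma_ne_zero_of_re_pos hs
  have h2 := regZeta_MMap (hreg 1 (by simp)) (β := b) (by rw [hM]; exact hreg b hb) (s := s) (by
    rintro ⟨k, hk, hk', -⟩
    omega)
  rw [hM, regZeta_of_lt hs0, regZeta_of_lt hs0, hray, hray, h1, inv_mul_cancel₀ hG, mul_one,
    inv_mul_eq_iff_eq_mul₀ hG] at h2
  exact h2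

/-- The linear form dominates `c(1 + ∑ m ℓ)`, and `1 + ∑ m ℓ` is at least each `1 + m ℓ`. Splitting
the exponent into `N` equal parts bounds the term by a product of powers with exponent `-σ/N < -1`.
-/
theorem summable_linear_rpow {N : ℕ} (hN : 1 ≤ N) {w σ : ℝ} {a : Fin N → ℝ} (hw : 0 < w)
    (ha : ∀ ℓ, 0 < a ℓ) (hσ : N < σ) :
    Summable fun m : Fin N → ℕ => (w + ∑ ℓ, m ℓ * a ℓ) ^ (-σ) := by
  have hN0 : (0 : ℝ) < N := by exact_mod_cast hN
  have hσ0 : 0 < σ := hN0.trans hσ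
  obtain ⟨c, hc, hcw, hca⟩ : ∃ c > 0, c ≤ w ∧ ∀ ℓ, c ≤ a ℓ := by
    have h1 : ∀ ℓ, ∀ᶠ c in 𝓝[>] (0 : ℝ), c ≤ a ℓ := fun ℓ => by
      filter_upwards [Ioo_mem_nhdsGT (ha ℓ)] with c hc using hc.2.le
    obtain ⟨c, h2, h3⟩ := ((eventually_all.mpr h1).and (Ioo_mem_nhdsGT hw)).exists
    exact ⟨c, h3.1, h3.2.le, h2⟩
  have hs1 : Summable fun k : ℕ => ‖((((k : ℝ) + 1) ^ (-(σ / N)) : ℝ) : ℂ)‖ := by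
    have h1 : Summable fun k : ℕ => ((k : ℝ)) ^ (-(σ / N)) :=
      Real.summable_nat_rpow.mpr (by rw [neg_lt_neg_iff, one_lt_div hN0]; exact hσ)
    refine ((summable_nat_add_iff 1).mpr h1).congr fun k => ?_
    rw [Complex.norm_of_nonneg (by positivity)]
    push_cast
    rfl
  have hs2 := (summable_norm_and_hasSum_prod (N := N)
    (fun _ k => ((((k : ℝ) + 1) ^ (-(σ / N)) : ℝ) : ℂ)) (fun _ => hs1)).1
  refine Summable.of_nonneg_of_le (fun m => ?_) (fun m => ?_) (hs2.mul_left (c ^ (-σ)))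
  · have : 0 ≤ ∑ ℓ, (m ℓ : ℝ) * a ℓ :=
      Finset.sum_nonneg fun ℓ _ => mul_nonneg (Nat.cast_nonneg _) (ha ℓ).le
    positivity
  · have hT : (0 : ℝ) < 1 + ∑ ℓ, (m ℓ : ℝ) := by positivity
    have h1 : c * (1 + ∑ ℓ, (m ℓ : ℝ)) ≤ w + ∑ ℓ, m ℓ * a ℓ := by
      rw [mul_add, mul_one, Finset.mul_sum]
      refine add_le_add hcw (Finset.sum_le_sum fun ℓ _ => ?_)
      rw [mul_comm]
      exact mul_le_mul_of_nonneg_left (hca ℓ) (Nat.cast_nonneg _)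
    calc (w + ∑ ℓ, m ℓ * a ℓ) ^ (-σ) ≤ (c * (1 + ∑ ℓ, (m ℓ : ℝ))) ^ (-σ) :=
          Real.rpow_le_rpow_of_nonpos (by positivity) h1 (by linarith)
      _ = c ^ (-σ) * ∏ _ℓ : Fin N, (1 + ∑ ℓ, (m ℓ : ℝ)) ^ (-(σ / N)) := by
        rw [Real.mul_rpow hc.le hT.le, Finset.prod_const, Finset.card_univ, Fintype.card_fin,
          ← Real.rpow_mul_natCast hT.le]
        congr 2
        field_simp
      _ ≤ c ^ (-σ) * ∏ ℓ : Fin N, ((m ℓ : ℝ) + 1) ^ (-(σ / N)) := by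
        refine mul_le_mul_of_nonneg_left ?_ (by positivity)
        refine Finset.prod_le_prod (fun _ _ => by positivity) fun ℓ _ => ?_
        refine Real.rpow_le_rpow_of_nonpos (by positivity) ?_
          (neg_nonpos.mpr (by positivity))
        have := Finset.single_le_sum (f := fun ℓ => (m ℓ : ℝ)) (fun _ _ => Nat.cast_nonneg _)
          (Finset.mem_univ ℓ)
        linarith
      _ = _ := by
        rw [norm_prod]
        congr 1
        refine Finset.prod_congr rfl fun ℓ _ => ?_
        rw [Complex.norm_of_nonneg (by positivity)]

theorem e_sum {ι : Type*} (t : Finset ι) (f : ι → ℂ) : e (∑ i ∈ t, f i) = ∏ i ∈ t, e (f i) := by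
  simp only [e, Finset.mul_sum, Complex.exp_sum]

theorem hasSum_testFun {N : ℕ} {δ : Params N} (hδ : δ ∈ TPlus N) {x : ℝ} (hx : 0 < x) :
    HasSum (fun m : Fin N → ℕ => e (∑ ℓ, (m ℓ : ℂ) * (δ.2.2 ℓ : ℂ)) *
      Complex.exp (-(x * (δ.1 + ∑ ℓ, (m ℓ : ℂ) * δ.2.1 ℓ)))) (testFun (x : ℂ) δ) := by
  have hnorm : ∀ ℓ, ‖e (δ.2.2 ℓ) * Complex.exp (-(x * δ.2.1 ℓ))‖ < 1 := by
    intro ℓ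
    rw [norm_mul, norm_e_ofReal, one_mul, Complex.norm_exp, Real.exp_lt_one_iff]
    simpa using mul_pos hx (hδ.2 ℓ)
  have h1 := (summable_norm_and_hasSum_prod
    (fun ℓ k => (e (δ.2.2 ℓ) * Complex.exp (-(x * δ.2.1 ℓ))) ^ k)
    (fun ℓ => by simpa only [norm_pow] using
      summable_geometric_of_lt_one (norm_nonneg _) (hnorm ℓ))).2
  simp only [fun ℓ => tsum_geometric_of_norm_lt_one (hnorm ℓ)] at h1
  refine (h1.mul_left (Complex.exp (-(x * δ.1)))).congr_fun fun m => ?_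
  rw [e_sum, mul_add, neg_add, Complex.exp_add, Finset.mul_sum, ← Finset.sum_neg_distrib,
    Complex.exp_sum, mul_left_comm, ← Finset.prod_mul_distrib]
  congr 1
  refine Finset.prod_congr rfl fun ℓ _ => ?_
  rw [mul_pow, ← Complex.exp_nat_mul, e, e, ← Complex.exp_nat_mul]
  congr 2 <;> ring

/-- The twisted Barnes series is represented by the half-line integral. -/
theorem hasSum_regZeta {N : ℕ} (hN : 1 ≤ N) {δ : Params N} (hδ : δ ∈ TPlus N) {s : ℂ}
    (hs : N < s.re) :
    HasSum (fun m : Fin N → ℕ => e (∑ ℓ, (m ℓ : ℂ) * (δ.2.2 ℓ : ℂ)) *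
      (δ.1 + ∑ ℓ, (m ℓ : ℂ) * δ.2.1 ℓ) ^ (-s)) (regZeta s δ) := by
  have hs0 : 0 < s.re := lt_of_le_of_lt (Nat.cast_nonneg N) hs
  have hG : Complex.Gamma s ≠ 0 := Complex.Gamma_ne_zero_of_re_pos hs0
  have hre : ∀ m : Fin N → ℕ, (δ.1 + ∑ ℓ, (m ℓ : ℂ) * δ.2.1 ℓ).re =
      δ.1.re + ∑ ℓ, (m ℓ : ℝ) * (δ.2.1 ℓ).re := by
    intro m
    simp
  have hpos : ∀ m : Fin N → ℕ, 0 < (δ.1 + ∑ ℓ, (m ℓ : ℂ) * δ.2.1 ℓ).re := by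
    intro m
    rw [hre]
    have : 0 ≤ ∑ ℓ, (m ℓ : ℝ) * (δ.2.1 ℓ).re :=
      Finset.sum_nonneg fun ℓ _ => mul_nonneg (Nat.cast_nonneg _) (hδ.2 ℓ).le
    have := hδ.1
    linarith
  have hnorm_e : ∀ m : Fin N → ℕ, ‖e (∑ ℓ, (m ℓ : ℂ) * (δ.2.2 ℓ : ℂ))‖ = 1 := by
    intro m
    have := norm_e_ofReal (∑ ℓ, (m ℓ : ℝ) * δ.2.2 ℓ)
    push_cast at this
    exact this
  have hint : ∀ m : Fin N → ℕ, IntegrableOn (fun x : ℝ => e (∑ ℓ, (m ℓ : ℂ) * (δ.2.2 ℓ : ℂ)) *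
      (Complex.exp (-(x * (δ.1 + ∑ ℓ, (m ℓ : ℂ) * δ.2.1 ℓ))) *
        Complex.exp ((s - 1) * Real.log x))) (Ioi 0) := fun m =>
    (integral_exp_neg_mul_cpow (hpos m) hs0).1.const_mul _
  -- The integral of the norm of the `m`-th term is `Γ(Re s) (Re (w + m·a))^(-Re s)`, which is
  -- summable.
  have hsum := hasSum_integral_of_summable_integral_norm hint (by
    refine ((summable_linear_rpow hN hδ.1 hδ.2 hs).mul_left (Real.Gamma s.re)).congr fun m => ?_
    rw [← hre m, mul_comm, Real.rpow_neg (hpos m).le, ← Real.inv_rpow (hpos m).le, ← one_div,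
      ← Real.integral_rpow_mul_exp_neg_mul_Ioi hs0 (hpos m)]
    refine setIntegral_congr_fun measurableSet_Ioi fun x hx => ?_
    rw [norm_mul, hnorm_e, one_mul, norm_mul, norm_exp_mul_log hx, Complex.norm_exp, mul_comm]
    congr 2
    simp [mul_comm])
  have hval : ∫ x in Ioi (0 : ℝ), ∑' m : Fin N → ℕ, e (∑ ℓ, (m ℓ : ℂ) * (δ.2.2 ℓ : ℂ)) *
      (Complex.exp (-(x * (δ.1 + ∑ ℓ, (m ℓ : ℂ) * δ.2.1 ℓ))) *
        Complex.exp ((s - 1) * Real.log x)) = rayIntegral 0 s δ := by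
    refine setIntegral_congr_fun measurableSet_Ioi fun x hx => ?_
    have := ((hasSum_testFun hδ hx).mul_right (Complex.exp ((s - 1) * Real.log x))).tsum_eq
    simpa only [mul_assoc] using this
  rw [hval] at hsum
  rw [regZeta_of_lt hs]
  refine (hsum.mul_left (Complex.Gamma s)⁻¹).congr_fun fun m => ?_
  rw [integral_const_mul, (integral_exp_neg_mul_cpow (hpos m) hs0).2, Complex.cpow_def_of_ne_zero
    (fun h => by have := hpos m; simp [h] at this)]
  field_simp

/-! ### The limit over rotations -/

theorem rot_mul_re (ω : ℝ) (z : ℂ) : (rot ω * z).re = Real.cos ω * z.re - Real.sin ω * z.im := by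
  rw [rot, mul_comm Complex.I, Complex.mul_re, Complex.exp_ofReal_mul_I_re,
    Complex.exp_ofReal_mul_I_im]

theorem rot_zero : rot 0 = 1 := by simp [rot]

theorem rot_ne_zero (ω : ℝ) : rot ω ≠ 0 := Complex.exp_ne_zero _

/-- Points with positive real part keep it under small rotations; the positive imaginary axis enters
the right half-plane only clockwise, hence the one-sided limit. -/
theorem eventually_rot_mul_re_pos {z : ℂ} (hz : z ∈ cone) :
    ∀ᶠ ω in 𝓝[<] (0 : ℝ), 0 < (rot ω * z).re := by
  rcases hz with h | ⟨h, h'⟩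
  · have hc : ContinuousAt (fun ω : ℝ => (rot ω * z).re) 0 := by
      unfold rot
      fun_prop
    exact (hc.eventually (lt_mem_nhds (by simpa [rot_zero] using h))).filter_mono nhdsWithin_le_nhds
  · filter_upwards [Ioo_mem_nhdsLT (neg_lt_zero.mpr Real.pi_pos)] with ω hω
    rw [rot_mul_re, h, mul_zero, zero_sub, Left.neg_pos_iff]
    exact mul_neg_of_neg_of_pos (Real.sin_neg_of_neg_of_neg_pi_lt hω.2 hω.1) h'

/-- The boundary version of the regular domain, with the half-plane replaced by the cone. -/
def coneDomain (N : ℕ) : Set (Params N) :=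
  {δ | δ.1 ∈ cone ∧ ∀ ℓ, (δ.2.1 ℓ = 0 ∧ e (δ.2.2 ℓ : ℂ) ≠ 1) ∨ δ.2.1 ℓ ∈ cone}

theorem eventually_MMap_rot_mem {N : ℕ} {δ : Params N} (hδ : δ ∈ coneDomain N) :
    ∀ᶠ ω in 𝓝[<] (0 : ℝ), MMap (rot ω) δ ∈ regDomain N := by
  refine (eventually_rot_mul_re_pos hδ.1).and (eventually_all.mpr fun ℓ => ?_)
  rcases hδ.2 ℓ with h | h
  · exact .of_forall fun ω => Or.inl ⟨by simp [MMap, h.1], h.2⟩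
  · exact (eventually_rot_mul_re_pos h).mono fun ω => Or.inr

/-- By `regZeta_rot` the function of `ω` is `exp(-iωs)` times a constant near `0⁻`. Angles in `(-1,
0]` differ by less than `π`. -/
theorem tendsto_regZeta_rot {N : ℕ} {δ : Params N} (hδ : δ ∈ coneDomain N) {ω₀ : ℝ}
    (h0 : -1 < ω₀) (h0' : ω₀ ≤ 0) (hω₀ : MMap (rot ω₀) δ ∈ regDomain N) {s : ℂ}
    (hs : s ∉ polePoints N) :
    Tendsto (fun ω => regZeta s (MMap (rot ω) δ)) (𝓝[<] 0)
      (𝓝 (Complex.exp (Complex.I * ω₀ * s) * regZeta s (MMap (rot ω₀) δ))) := by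
  have hlim : Tendsto (fun ω : ℝ => Complex.exp (-(Complex.I * ω * s)) *
      (Complex.exp (Complex.I * ω₀ * s) * regZeta s (MMap (rot ω₀) δ))) (𝓝[<] 0)
      (𝓝 (Complex.exp (Complex.I * ω₀ * s) * regZeta s (MMap (rot ω₀) δ))) := by
    have hc : Continuous fun ω : ℝ => Complex.exp (-(Complex.I * ω * s)) *
      (Complex.exp (Complex.I * ω₀ * s) * regZeta s (MMap (rot ω₀) δ)) := by fun_prop
    exact (hc.tendsto' 0 _ (by simp)).mono_left nhdsWithin_le_nhds
  refine hlim.congr' ?_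
  filter_upwards [eventually_MMap_rot_mem hδ, Ioo_mem_nhdsLT (show (-1 : ℝ) < 0 by norm_num)]
    with ω hω hω'
  have hpi := Real.pi_gt_three
  rw [← regZeta_rot hω₀ hω (by linarith [hω'.1]) (by linarith [hω'.2]) hs, ← mul_assoc,
    ← Complex.exp_add, neg_add_cancel, Complex.exp_zero, one_mul]

theorem exists_rot_mem {N : ℕ} {δ : Params N} (hδ : δ ∈ coneDomain N) :
    ∃ ω₀ : ℝ, -1 < ω₀ ∧ ω₀ < 0 ∧ MMap (rot ω₀) δ ∈ regDomain N := by
  obtain ⟨ω, h1, h2⟩ := ((eventually_MMap_rot_mem hδ).and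
    (Ioo_mem_nhdsLT (show (-1 : ℝ) < 0 by norm_num))).exists
  exact ⟨ω, h2.1, h2.2, h1⟩

theorem TMap_MMap {N : ℕ} (Λ : Finset (Fin N)) (α : ℂ) (δ : Params N) :
    TMap Λ (MMap α δ) = MMap α (TMap Λ δ) := by
  simp only [TMap, MMap, trace, mul_sub, Finset.mul_sum, Prod.mk.injEq, and_true, true_and]
  ext ℓ
  split_ifs <;> ring

theorem TMap_TMap {N : ℕ} (Λ : Finset (Fin N)) (δ : Params N) : TMap Λ (TMap Λ δ) = δ := by
  obtain ⟨w, a, θ⟩ := δ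
  have h : ∑ ℓ ∈ Λ, (if ℓ ∈ Λ then -a ℓ else a ℓ) = -∑ ℓ ∈ Λ, a ℓ := by
    rw [← Finset.sum_neg_distrib]
    exact Finset.sum_congr rfl fun ℓ hℓ => if_pos hℓ
  simp only [TMap, trace, h, Prod.mk.injEq]
  refine ⟨by ring, ?_, ?_⟩ <;>
  · ext ℓ
    split_ifs <;> simp

theorem mem_negIndices {N : ℕ} {a : Fin N → ℂ} {ℓ : Fin N} : ℓ ∈ negIndices a ↔ -(a ℓ) ∈ cone := by
  simp [negIndices]

theorem eq_zero_or_mem_cone (z : ℂ) : z = 0 ∨ z ∈ cone ∨ -z ∈ cone := by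
  simp only [cone, mem_ofPred_eq, Complex.neg_re, Complex.neg_im]
  rcases lt_trichotomy z.re 0 with h | h | h
  · right; right; left; linarith
  · rcases lt_trichotomy z.im 0 with h' | h' | h'
    · right; right; right; constructor <;> linarith
    · exact Or.inl (Complex.ext h h')
    · exact Or.inr (Or.inl (Or.inr ⟨h, h'⟩))
  · exact Or.inr (Or.inl (Or.inl h))

/-- The first entry after this reflection is exactly `piMap δ`, which is why `extDomain` is defined
through it. -/
theorem TMap_negIndices_mem_coneDomain {N : ℕ} {δ : Params N} (hδ : δ ∈ extDomain N) :
    TMap (negIndices δ.2.1) δ ∈ coneDomain N := by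
  refine ⟨hδ.2, fun ℓ => ?_⟩
  by_cases h : ℓ ∈ negIndices δ.2.1
  · exact Or.inr (by simpa only [TMap, if_pos h] using mem_negIndices.mp h)
  · simp only [TMap, if_neg h]
    rcases eq_zero_or_mem_cone (δ.2.1 ℓ) with h0 | h1 | h1
    · refine Or.inl ⟨h0, fun h2 => ?_⟩
      obtain ⟨n, hn⟩ := (e_ofReal_eq_one_iff _).mp h2
      exact hδ.1 ℓ h0 n hn
    · exact Or.inr h1
    · exact absurd (mem_negIndices.mpr h1) h

/-- The limit of the Hankel quotients as the rotation angle tends to `0` from below. -/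
noncomputable def zetaLimit {N : ℕ} (s : ℂ) (δ : Params N) : ℂ :=
  reflConst (negIndices δ.2.1) δ.2.2 *
    limUnder (𝓝[<] (0 : ℝ)) fun ω => regZeta s (MMap (rot ω) (TMap (negIndices δ.2.1) δ))

/-- A fixed angle `ω₀` replaces the limit, so analytic properties in `s` pass from `regZeta`. The
value `ω₀ = 0` is allowed for parameters that need no rotation. -/
theorem zetaLimit_eq {N : ℕ} {δ : Params N} (hδ : TMap (negIndices δ.2.1) δ ∈ coneDomain N) {ω₀ : ℝ}
    (h0 : -1 < ω₀) (h0' : ω₀ ≤ 0)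
    (hω₀ : MMap (rot ω₀) (TMap (negIndices δ.2.1) δ) ∈ regDomain N) {s : ℂ}
    (hs : s ∉ polePoints N) :
    zetaLimit s δ = reflConst (negIndices δ.2.1) δ.2.2 * (Complex.exp (Complex.I * ω₀ * s) *
      regZeta s (MMap (rot ω₀) (TMap (negIndices δ.2.1) δ))) := by
  rw [zetaLimit, (tendsto_regZeta_rot hδ h0 h0' hω₀ hs).limUnder_eq]

theorem tendsto_LEps {N : ℕ} {ε : Params N → ℝ} (hε : ε ∈ radii N) {s : ℂ} (hs : s ∉ polePoints N)
    {δ : Params N} (hδ : δ ∈ extDomain N) :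
    Tendsto (fun ω : ℝ => LEps ε s (MMap (rot ω) δ)) (𝓝[<] 0) (𝓝 (zetaLimit s δ)) := by
  have hd := TMap_negIndices_mem_coneDomain hδ
  obtain ⟨ω₀, h1, h2, h3⟩ := exists_rot_mem hd
  rw [zetaLimit_eq hd h1 h2.le h3 hs]
  refine ((tendsto_regZeta_rot hd h1 h2.le h3 hs).const_mul _).congr' ?_
  filter_upwards [eventually_MMap_rot_mem hd] with ω hω
  rw [← TMap_MMap] at hω ⊢
  exact (LEps_eq_regZeta hε hω hs).symm

theorem eventually_hankelConverges_and_tendsto {N : ℕ} {δ : Params N} (hδ : δ ∈ extDomain N) :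
    ∀ᶠ ω : ℝ in 𝓝[<] 0, ∀ ε ∈ radii N,
      (∀ s : ℂ, HankelConverges (ε (MMap (rot ω) δ)) s (MMap (rot ω) δ)) ∧
      ∀ s ∉ polePoints N, Tendsto (fun z => hankelQuotient ε z (MMap (rot ω) δ)) (𝓝[≠] s)
        (𝓝 (LEps ε s (MMap (rot ω) δ))) := by
  filter_upwards [eventually_MMap_rot_mem (TMap_negIndices_mem_coneDomain hδ)] with ω hω ε hε
  rw [← TMap_MMap] at hω
  refine ⟨fun s => ?_, fun s hs => ?_⟩
  · refine hankelConverges_of_TMap (negIndices δ.2.1) _ _ _ (hankelConverges_of_mem_regDomain hω ?_ s)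
    rw [admissible_TMap_iff]
    exact admissible_of_mem_radii hε
      ((mem_goodDomain_TMap_iff _ _).mp (regDomain_subset_goodDomain hω))
  · rw [LEps_eq_regZeta hε hω hs]
    exact tendsto_hankelQuotient hε hω hs

theorem differentiableOn_zetaLimit_left {N : ℕ} {δ : Params N} (hδ : δ ∈ extDomain N) :
    DifferentiableOn ℂ (fun s => zetaLimit s δ) (polePoints N)ᶜ := by
  have hd := TMap_negIndices_mem_coneDomain hδ
  obtain ⟨ω₀, h1, h2, h3⟩ := exists_rot_mem hd
  refine DifferentiableOn.congr (fun s hs => ?_) fun s hs => zetaLimit_eq hd h1 h2.le h3 hs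
  have := differentiableAt_regZeta_left h3 hs
  refine DifferentiableAt.differentiableWithinAt ?_
  fun_prop

theorem meromorphicAt_zetaLimit {N : ℕ} {δ : Params N} (hδ : δ ∈ extDomain N) {k : ℂ}
    (hk : k ∈ polePoints N) : MeromorphicAt (fun s => zetaLimit s δ) k ∧
      ((-1 : ℤ) : WithTop ℤ) ≤ meromorphicOrderAt (fun s => zetaLimit s δ) k := by
  have hd := TMap_negIndices_mem_coneDomain hδ
  obtain ⟨ω₀, h1, h2, h3⟩ := exists_rot_mem hd
  have hcongr : (fun s => (reflConst (negIndices δ.2.1) δ.2.2 * Complex.exp (Complex.I * ω₀ * s)) *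
      regZeta s (MMap (rot ω₀) (TMap (negIndices δ.2.1) δ))) =ᶠ[𝓝[≠] k]
      fun s => zetaLimit s δ := by
    filter_upwards [eventually_not_int k] with s hs
    rw [zetaLimit_eq hd h1 h2.le h3, mul_assoc]
    rintro ⟨n, -, -, rfl⟩
    exact hs ⟨n, by simp⟩
  obtain ⟨h4, h5⟩ := meromorphicAt_mul_regZeta h3
    (g := fun s => reflConst (negIndices δ.2.1) δ.2.2 * Complex.exp (Complex.I * ω₀ * s))
    (by fun_prop) hk
  exact ⟨h4.congr hcongr, by rwa [← meromorphicOrderAt_congr hcongr]⟩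

theorem TPlus_subset_regDomain {N : ℕ} : TPlus N ⊆ regDomain N := fun _ h =>
  ⟨h.1, fun ℓ => Or.inr (h.2 ℓ)⟩

theorem regDomain_subset_coneDomain {N : ℕ} : regDomain N ⊆ coneDomain N := fun _ h =>
  ⟨Or.inl h.1, fun ℓ => (h.2 ℓ).imp_right Or.inl⟩

/-- The set of reflected indices is constant on `T_Λ(TPlus)`; this makes joint holomorphy there
possible. -/
theorem negIndices_eq_of_TMap_mem {N : ℕ} {Λ : Finset (Fin N)} {δ : Params N}
    (h : TMap Λ δ ∈ TPlus N) : negIndices δ.2.1 = Λ := by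
  ext ℓ
  have h1 := h.2 ℓ
  rw [mem_negIndices]
  by_cases hℓ : ℓ ∈ Λ
  · simp only [TMap, if_pos hℓ] at h1
    exact iff_of_true (Or.inl h1) hℓ
  · simp only [TMap, if_neg hℓ] at h1
    refine iff_of_false ?_ hℓ
    simp only [cone, mem_ofPred_eq, Complex.neg_re, not_or, not_and]
    exact ⟨by linarith, fun h2 => by linarith⟩

theorem zetaLimit_eq_of_TMap_mem {N : ℕ} {Λ : Finset (Fin N)} {δ : Params N}
    (h : TMap Λ δ ∈ TPlus N) {s : ℂ} (hs : s ∉ polePoints N) :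
    zetaLimit s δ = reflConst Λ δ.2.2 * regZeta s (TMap Λ δ) := by
  have h1 := TPlus_subset_regDomain h
  have hΛ := negIndices_eq_of_TMap_mem h
  rw [zetaLimit_eq (ω₀ := 0) (by rw [hΛ]; exact regDomain_subset_coneDomain h1) (by norm_num) le_rfl
    (by rwa [hΛ, rot_zero, MMap_one]) hs, hΛ, rot_zero, MMap_one]
  simp

theorem mem_TPlus_iff {N : ℕ} (δ : Params N) : δ ∈ TPlus N ↔ (δ.1, δ.2.1) ∈ maskDomain (N := N) ∅ := by
  simp [TPlus, maskDomain]

theorem maskParams_empty {N : ℕ} (θ : Fin N → ℝ) (q : ℂ × (Fin N → ℂ)) :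
    maskParams ∅ θ q = (q.1, q.2, θ) := by
  simp [maskParams]

theorem differentiableOn_zetaLimit {N : ℕ} (θ : Fin N → ℝ) (Λ : Finset (Fin N)) :
    DifferentiableOn ℂ (fun q : ℂ × ℂ × (Fin N → ℂ) => zetaLimit q.1 (q.2.1, q.2.2, θ))
      ((polePoints N)ᶜ ×ˢ (proj '' (TMap Λ '' TPlus N))) := by
  -- `TPlus` puts no condition on `θ`, so membership after reflection depends only on `(w, a)`.
  have hmem : ∀ q ∈ proj '' (TMap Λ '' TPlus N), TMap Λ (q.1, q.2, θ) ∈ TPlus N := by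
    rintro _ ⟨_, ⟨δ, hδ, rfl⟩, rfl⟩
    have h1 := TMap_TMap Λ δ
    have h2 : ∀ θ', (TMap Λ ((TMap Λ δ).1, (TMap Λ δ).2.1, θ')).1 = δ.1 ∧
        (TMap Λ ((TMap Λ δ).1, (TMap Λ δ).2.1, θ')).2.1 = δ.2.1 := by
      intro θ'
      have h3 := congrArg Prod.fst h1
      have h4 := congrArg (fun δ => δ.2.1) h1
      exact ⟨h3, h4⟩
    rw [mem_TPlus_iff] at hδ ⊢
    rwa [proj, (h2 θ).1, (h2 θ).2]
  refine DifferentiableOn.congr (f := fun p : ℂ × ℂ × (Fin N → ℂ) => reflConst Λ θ *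
    regZeta p.1 (maskParams ∅ (fun ℓ => if ℓ ∈ Λ then -θ ℓ else θ ℓ)
      (p.2.1 - ∑ ℓ ∈ Λ, p.2.2 ℓ, fun ℓ => if ℓ ∈ Λ then -p.2.2 ℓ else p.2.2 ℓ)))
    (fun p hp => ?_) fun p hp => ?_
  · refine DifferentiableAt.differentiableWithinAt (DifferentiableAt.const_mul ?_ _)
    have hq := (mem_TPlus_iff _).mp (hmem p.2 hp.2)
    refine DifferentiableAt.comp (f := fun p : ℂ × ℂ × (Fin N → ℂ) =>
      (p.1, (p.2.1 - ∑ ℓ ∈ Λ, p.2.2 ℓ, fun ℓ => if ℓ ∈ Λ then -p.2.2 ℓ else p.2.2 ℓ))) p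
      (differentiableAt_regZeta (by simp) hq hp.1) ?_
    refine DifferentiableAt.prodMk (by fun_prop) (DifferentiableAt.prodMk (by fun_prop) ?_)
    rw [differentiableAt_pi]
    intro ℓ
    by_cases h : ℓ ∈ Λ
    · simp only [if_pos h]
      fun_prop
    · simp only [if_neg h]
      fun_prop
  · rw [maskParams_empty]
    exact zetaLimit_eq_of_TMap_mem (hmem p.2 hp.2) hp.1

/-! ### Existence and uniqueness of the twisted Barnes zeta function -/

theorem mem_proj_TExt {N : ℕ} {q : ℂ × (Fin N → ℂ)} : q ∈ proj '' TExt N ↔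
    ∃ ω : ℝ, -(Real.pi / 2) < ω ∧ ω < Real.pi / 2 ∧
      (rot ω * q.1, fun ℓ => rot ω * q.2 ℓ) ∈ maskDomain (N := N) ∅ := by
  constructor
  · rintro ⟨δ, ⟨ω, h1, h2, h3⟩, rfl⟩
    exact ⟨ω, h1, h2, (mem_TPlus_iff _).mp h3⟩
  · rintro ⟨ω, h1, h2, h3⟩
    exact ⟨(q.1, q.2, 0), ⟨ω, h1, h2, (mem_TPlus_iff _).mpr h3⟩, rfl⟩

theorem isOpen_proj_TExt (N : ℕ) : IsOpen (proj '' TExt N) := by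
  rw [isOpen_iff_mem_nhds]
  intro q hq
  obtain ⟨ω, h1, h2, h3⟩ := mem_proj_TExt.mp hq
  have hc : ContinuousAt (fun q : ℂ × (Fin N → ℂ) => (rot ω * q.1, fun ℓ => rot ω * q.2 ℓ)) q := by
    fun_prop
  filter_upwards [hc.eventually ((isOpen_maskDomain ∅).mem_nhds h3)] with q' hq'
  exact mem_proj_TExt.mpr ⟨ω, h1, h2, hq'⟩

theorem countable_polePoints (N : ℕ) : (polePoints N).Countable :=
  (countable_range fun k : ℕ => (k : ℂ)).mono (by rintro _ ⟨k, -, -, rfl⟩; exact ⟨k, rfl⟩)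

theorem isOpen_compl_polePoints (N : ℕ) : IsOpen (polePoints N)ᶜ := by
  refine ((finite_Icc 1 N).image fun k : ℕ => (k : ℂ)).subset ?_ |>.isClosed.isOpen_compl
  rintro _ ⟨k, h1, h2, rfl⟩
  exact ⟨k, ⟨h1, h2⟩, rfl⟩

open Classical in
/-- The continued twisted Barnes zeta function. -/
noncomputable def barnesZeta {N : ℕ} (θ : Fin N → ℝ) (p : ℂ × ℂ × (Fin N → ℂ)) : ℂ :=
  if h : ∃ ω : ℝ, -(Real.pi / 2) < ω ∧ ω < Real.pi / 2 ∧
      (rot ω * p.2.1, fun ℓ => rot ω * p.2.2 ℓ) ∈ maskDomain (N := N) ∅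
  then Complex.exp (Complex.I * h.choose * p.1) * regZeta p.1 (MMap (rot h.choose) (p.2.1, p.2.2, θ))
  else 0

/-- The chosen angle is immaterial: two angles in `(-π/2, π/2)` differ by less than `π`, so
`regZeta_rot` applies. -/
theorem barnesZeta_eq {N : ℕ} {θ : Fin N → ℝ} {p : ℂ × ℂ × (Fin N → ℂ)} {ω : ℝ}
    (h1 : -(Real.pi / 2) < ω) (h2 : ω < Real.pi / 2)
    (h3 : (rot ω * p.2.1, fun ℓ => rot ω * p.2.2 ℓ) ∈ maskDomain (N := N) ∅)
    (hs : p.1 ∉ polePoints N) : barnesZeta θ p =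
      Complex.exp (Complex.I * ω * p.1) * regZeta p.1 (MMap (rot ω) (p.2.1, p.2.2, θ)) := by
  have h : ∃ ω : ℝ, -(Real.pi / 2) < ω ∧ ω < Real.pi / 2 ∧
      (rot ω * p.2.1, fun ℓ => rot ω * p.2.2 ℓ) ∈ maskDomain (N := N) ∅ := ⟨ω, h1, h2, h3⟩
  have hreg : ∀ ω, (rot ω * p.2.1, fun ℓ => rot ω * p.2.2 ℓ) ∈ maskDomain (N := N) ∅ →
      MMap (rot ω) (p.2.1, p.2.2, θ) ∈ regDomain N := fun ω hω =>
    TPlus_subset_regDomain ((mem_TPlus_iff _).mpr hω)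
  obtain ⟨h4, h5, h6⟩ := h.choose_spec
  rw [barnesZeta, dif_pos h]
  exact regZeta_rot (hreg _ h3) (hreg _ h6) (by linarith) (by linarith) hs

theorem isTwistedBarnesZeta_barnesZeta {N : ℕ} (hN : 1 ≤ N) (θ : Fin N → ℝ) :
    IsTwistedBarnesZeta N θ (barnesZeta θ) := by
  refine ⟨fun p hp => ?_, fun s w a hs hwa => ?_⟩
  · obtain ⟨ω, h1, h2, h3⟩ := mem_proj_TExt.mp hp.2
    have hd : DifferentiableAt ℂ (fun p : ℂ × ℂ × (Fin N → ℂ) => Complex.exp (Complex.I * ω * p.1) *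
        regZeta p.1 (maskParams ∅ θ (rot ω * p.2.1, fun ℓ => rot ω * p.2.2 ℓ))) p := by
      refine DifferentiableAt.mul (by fun_prop) ?_
      exact DifferentiableAt.comp (f := fun p : ℂ × ℂ × (Fin N → ℂ) =>
        (p.1, (rot ω * p.2.1, fun ℓ => rot ω * p.2.2 ℓ))) p
        (differentiableAt_regZeta (by simp) h3 hp.1) (by fun_prop)
    have heq : ∀ p' : ℂ × ℂ × (Fin N → ℂ), p'.1 ∉ polePoints N →
        (rot ω * p'.2.1, fun ℓ => rot ω * p'.2.2 ℓ) ∈ maskDomain (N := N) ∅ →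
        barnesZeta θ p' = Complex.exp (Complex.I * ω * p'.1) *
        regZeta p'.1 (maskParams ∅ θ (rot ω * p'.2.1, fun ℓ => rot ω * p'.2.2 ℓ)) := by
      intro p' h4 h5
      rw [barnesZeta_eq h1 h2 h5 h4, maskParams_empty]
      rfl
    refine hd.differentiableWithinAt.congr_of_eventuallyEq ?_ (heq p hp.1 h3)
    have hc : ContinuousAt (fun p : ℂ × ℂ × (Fin N → ℂ) =>
      (rot ω * p.2.1, fun ℓ => rot ω * p.2.2 ℓ)) p := by fun_prop
    filter_upwards [self_mem_nhdsWithin,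
      (hc.eventually ((isOpen_maskDomain ∅).mem_nhds h3)).filter_mono nhdsWithin_le_nhds]
      with p' h4 h5 using heq p' h4.1 h5
  · have hs' : s ∉ polePoints N := by
      rintro ⟨k, -, hk, rfl⟩
      rw [Complex.natCast_re] at hs
      exact absurd hk (not_le.mpr (by exact_mod_cast hs))
    have h3 : (rot 0 * w, fun ℓ => rot 0 * a ℓ) ∈ maskDomain (N := N) ∅ := by
      simpa only [rot_zero, one_mul] using (mem_TPlus_iff _).mp hwa
    rw [barnesZeta_eq (p := (s, w, a)) (ω := 0) (by linarith [Real.pi_pos])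
      (by linarith [Real.pi_pos]) h3 hs', rot_zero, MMap_one]
    simpa using hasSum_regZeta hN hwa hs

theorem zetaLimit_eq_barnesZeta {N : ℕ} (θ : Fin N → ℝ) {s : ℂ} (hs : s ∉ polePoints N) {w : ℂ}
    (hw : w ∈ cone) {a : Fin N → ℂ} (ha : ∀ ℓ, a ℓ ∈ cone) :
    zetaLimit s (w, a, θ) = barnesZeta θ (s, w, a) := by
  have hne : ∀ z ∈ cone, -z ∉ cone := by
    intro z hz
    simp only [cone, mem_ofPred_eq, Complex.neg_re, Complex.neg_im] at hz ⊢
    rintro (h | ⟨h, h2⟩) <;> rcases hz with h' | ⟨h', h2'⟩ <;> linarith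
  have hneg : negIndices a = ∅ := by
    ext ℓ
    simpa [mem_negIndices] using hne _ (ha ℓ)
  have hT : ∀ δ : Params N, TMap ∅ δ = δ := fun δ => by simp [TMap, trace]
  have hd : ((w, a, θ) : Params N) ∈ coneDomain N := ⟨hw, fun ℓ => Or.inr (ha ℓ)⟩
  obtain ⟨ω₀, h1, h2, h3⟩ := exists_rot_mem hd
  have h4 := zetaLimit_eq (δ := (w, a, θ)) (by rwa [hneg, hT]) h1 h2.le (by rwa [hneg, hT]) hs
  have hpi := Real.pi_gt_three
  have h5 : (rot ω₀ * w, fun ℓ => rot ω₀ * a ℓ) ∈ maskDomain (N := N) ∅ := by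
    refine ⟨h3.1, fun ℓ _ => ?_⟩
    rcases h3.2 ℓ with h | h
    · have h6 : a ℓ = 0 := by simpa [MMap, rot_ne_zero] using h.1
      have := ha ℓ
      simp [h6, cone] at this
    · exact h
  rw [h4, hneg, hT, barnesZeta_eq (p := (s, w, a)) (by linarith) (by linarith) h5 hs, reflConst,
    Finset.prod_empty, one_mul]

/-- For fixed `(w, a)` the series determines the function near `s = N + 1`, and the complement of
countably many points in the plane is connected. -/
theorem IsTwistedBarnesZeta.eq_of_mem_TPlus {N : ℕ} {θ : Fin N → ℝ}
    {Z Z' : ℂ × ℂ × (Fin N → ℂ) → ℂ} (hZ : IsTwistedBarnesZeta N θ Z)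
    (hZ' : IsTwistedBarnesZeta N θ Z') {q : ℂ × (Fin N → ℂ)} (hq : q ∈ maskDomain (N := N) ∅) {s : ℂ}
    (hs : s ∉ polePoints N) : Z (s, q) = Z' (s, q) := by
  have hmem : q ∈ proj '' TExt N := mem_proj_TExt.mpr ⟨0, by linarith [Real.pi_pos],
    by linarith [Real.pi_pos], by simpa only [rot_zero, one_mul] using hq⟩
  have han : ∀ Y, IsTwistedBarnesZeta N θ Y →
      AnalyticOnNhd ℂ (fun s => Y (s, q)) (polePoints N)ᶜ := by
    intro Y hY
    refine DifferentiableOn.analyticOnNhd ?_ (isOpen_compl_polePoints N)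
    exact hY.1.comp (f := fun s : ℂ => (s, q)) (by fun_prop) fun s hs => ⟨hs, hmem⟩
  have hconn : IsPreconnected (polePoints N)ᶜ :=
    ((countable_polePoints N).isConnected_compl_of_one_lt_rank
      (by simp [Complex.rank_real_complex])).isPreconnected
  have h0 : ((N : ℂ) + 1) ∈ (polePoints N)ᶜ := by
    rintro ⟨k, -, hk, h⟩
    have : N + 1 = k := by exact_mod_cast h
    omega
  refine (han Z hZ).eqOn_of_preconnected_of_eventuallyEq (han Z' hZ') hconn h0 ?_ hs
  have hc : ContinuousAt Complex.re ((N : ℂ) + 1) := by fun_prop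
  filter_upwards [hc.eventually (lt_mem_nhds (show (N : ℝ) < ((N : ℂ) + 1).re by simp))] with z hz
  exact (hZ.2 z q.1 q.2 hz ((mem_TPlus_iff _).mpr hq)).unique
    (hZ'.2 z q.1 q.2 hz ((mem_TPlus_iff _).mpr hq))

/-- The twisted Barnes zeta function is unique on its domain. -/
theorem IsTwistedBarnesZeta.eqOn {N : ℕ} {θ : Fin N → ℝ} {Z Z' : ℂ × ℂ × (Fin N → ℂ) → ℂ}
    (hZ : IsTwistedBarnesZeta N θ Z) (hZ' : IsTwistedBarnesZeta N θ Z') :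
    EqOn Z Z' ((polePoints N)ᶜ ×ˢ (proj '' TExt N)) := by
  rintro ⟨s, q⟩ ⟨hs, hq⟩
  obtain ⟨ω, h1, h2, h3⟩ := mem_proj_TExt.mp hq
  -- The curve joins `q` at `t = 0` to a point of the unrotated domain at `t = ω`, where equality is
  -- known nearby. For `t` between, rotation by `ω - t` certifies that `c t` stays in the domain.
  let c : ℂ → ℂ × (Fin N → ℂ) := fun t =>
    (Complex.exp (Complex.I * t) * q.1, fun ℓ => Complex.exp (Complex.I * t) * q.2 ℓ)
  have hc : Differentiable ℂ c := by fun_prop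
  have hopen : IsOpen (c ⁻¹' (proj '' TExt N)) := (isOpen_proj_TExt N).preimage hc.continuous
  have hsub : (fun t : ℝ => (t : ℂ)) '' uIcc 0 ω ⊆ c ⁻¹' (proj '' TExt N) := by
    rintro _ ⟨t, ht, rfl⟩
    have hrot : ∀ z, rot (ω - t) * (rot t * z) = rot ω * z := by
      intro z
      rw [← mul_assoc, rot, rot, rot, ← Complex.exp_add]
      congr 2
      push_cast
      ring
    refine mem_proj_TExt.mpr ⟨ω - t, ?_, ?_, ?_⟩
    · rcases mem_uIcc.mp ht with ⟨h4, h5⟩ | ⟨h4, h5⟩ <;> linarith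
    · rcases mem_uIcc.mp ht with ⟨h4, h5⟩ | ⟨h4, h5⟩ <;> linarith
    · change (rot (ω - t) * (rot t * q.1), fun ℓ => rot (ω - t) * (rot t * q.2 ℓ)) ∈ _
      simpa only [hrot] using h3
  have han : ∀ Y, IsTwistedBarnesZeta N θ Y →
      AnalyticOnNhd ℂ (fun t => Y (s, c t)) ((fun t : ℝ => (t : ℂ)) '' uIcc 0 ω) := by
    intro Y hY
    refine (DifferentiableOn.analyticOnNhd ?_ hopen).mono hsub
    exact hY.1.comp (f := fun t : ℂ => (s, c t)) (by fun_prop) fun t ht => ⟨hs, ht⟩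
  have hpre : IsPreconnected ((fun t : ℝ => (t : ℂ)) '' uIcc 0 ω) :=
    isPreconnected_uIcc.image _ Complex.continuous_ofReal.continuousOn
  have hω : c ω ∈ maskDomain (N := N) ∅ := h3
  have h := (han Z hZ).eqOn_of_preconnected_of_eventuallyEq (han Z' hZ') hpre
    ⟨ω, right_mem_uIcc, rfl⟩ (by
      filter_upwards [hc.continuous.continuousAt.eventually ((isOpen_maskDomain ∅).mem_nhds hω)]
        with t ht using hZ.eq_of_mem_TPlus hZ' ht hs) ⟨0, left_mem_uIcc, rfl⟩
  have hc0 : c ((0 : ℝ) : ℂ) = q := by simp [c]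
  simpa only [hc0] using h

theorem mem_proj_TExt_of_mem_cone {N : ℕ} {w : ℂ} (hw : w ∈ cone) {a : Fin N → ℂ}
    (ha : ∀ ℓ, a ℓ ∈ cone) : (w, a) ∈ proj '' TExt N := by
  have h := (eventually_rot_mul_re_pos hw).and
    (eventually_all.mpr fun ℓ => eventually_rot_mul_re_pos (ha ℓ))
  obtain ⟨ω, ⟨h1, h2⟩, h3⟩ := (h.and
    (Ioo_mem_nhdsLT (neg_lt_zero.mpr (half_pos Real.pi_pos)))).exists
  exact mem_proj_TExt.mpr ⟨ω, h3.1, by linarith [h3.2, Real.pi_pos], h1, fun ℓ _ => h2 ℓ⟩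

end TwistedBarnes

theorem theorem1 (N : ℕ) (hN : 1 ≤ N) :
    (TwistedBarnes.radii N).Nonempty ∧
    (∀ δ ∈ TwistedBarnes.extDomain N, ∀ᶠ ω : ℝ in 𝓝[<] 0, ∀ ε ∈ TwistedBarnes.radii N,
      (∀ s : ℂ, TwistedBarnes.HankelConverges
        (ε (TwistedBarnes.MMap (Complex.exp (Complex.I * ω)) δ)) s
        (TwistedBarnes.MMap (Complex.exp (Complex.I * ω)) δ)) ∧
      ∀ s ∉ TwistedBarnes.polePoints N,
        Tendsto (fun z => TwistedBarnes.hankelQuotient ε z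
            (TwistedBarnes.MMap (Complex.exp (Complex.I * ω)) δ)) (𝓝[≠] s)
          (𝓝 (TwistedBarnes.LEps ε s
            (TwistedBarnes.MMap (Complex.exp (Complex.I * ω)) δ)))) ∧
    ∃ L : ℂ → TwistedBarnes.Params N → ℂ,
      (∀ ε ∈ TwistedBarnes.radii N, ∀ s ∉ TwistedBarnes.polePoints N,
        ∀ δ ∈ TwistedBarnes.extDomain N,
          Tendsto (fun ω : ℝ => TwistedBarnes.LEps ε s
              (TwistedBarnes.MMap (Complex.exp (Complex.I * ω)) δ)) (𝓝[<] 0) (𝓝 (L s δ))) ∧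
      (∀ δ ∈ TwistedBarnes.extDomain N,
        DifferentiableOn ℂ (fun s => L s δ) (TwistedBarnes.polePoints N)ᶜ ∧
        ∀ k ∈ TwistedBarnes.polePoints N, MeromorphicAt (fun s => L s δ) k ∧
          ((-1 : ℤ) : WithTop ℤ) ≤ meromorphicOrderAt (fun s => L s δ) k) ∧
      (∀ (θ : Fin N → ℝ) (Λ : Finset (Fin N)),
        DifferentiableOn ℂ (fun q : ℂ × ℂ × (Fin N → ℂ) => L q.1 (q.2.1, q.2.2, θ))
          ((TwistedBarnes.polePoints N)ᶜ ×ˢ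
            (TwistedBarnes.proj '' (TwistedBarnes.TMap Λ '' TwistedBarnes.TPlus N)))) ∧
      ∀ θ : Fin N → ℝ,
        (∃ Z, TwistedBarnes.IsTwistedBarnesZeta N θ Z) ∧
        ∀ Z, TwistedBarnes.IsTwistedBarnesZeta N θ Z →
          ∀ s ∉ TwistedBarnes.polePoints N, ∀ w ∈ TwistedBarnes.cone,
            ∀ a : Fin N → ℂ, (∀ ℓ, a ℓ ∈ TwistedBarnes.cone) →
              L s (w, a, θ) = Z (s, w, a) := by
  refine ⟨TwistedBarnes.radii_nonempty N,
    fun δ hδ => TwistedBarnes.eventually_hankelConverges_and_tendsto hδ,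
    TwistedBarnes.zetaLimit, fun ε hε s hs δ hδ => TwistedBarnes.tendsto_LEps hε hs hδ,
    fun δ hδ => ⟨TwistedBarnes.differentiableOn_zetaLimit_left hδ,
      fun k hk => TwistedBarnes.meromorphicAt_zetaLimit hδ hk⟩,
    TwistedBarnes.differentiableOn_zetaLimit, fun θ => ?_⟩
  have hζ := TwistedBarnes.isTwistedBarnesZeta_barnesZeta hN θ
  refine ⟨⟨_, hζ⟩, fun Z hZ s hs w hw a ha => ?_⟩
  rw [TwistedBarnes.zetaLimit_eq_barnesZeta θ hs hw ha]
  exact hζ.eqOn hZ ⟨hs, TwistedBarnes.mem_proj_TExt_of_mem_cone hw ha⟩
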